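/- Let $K$ be a field of characteristic $0$ and let $(A_\mu,B_\nu,\vartriangleright,\vartriangleleft,\rightharpoonup,\leftharpoonup,\theta)$ be a quasi-twilled associative algebra over $K$, i.e. bilinear maps $\mu:A\times A\to A$, $\nu:B\times B\to B$, $\vartriangleright:A\times B\to B$, $\vartriangleleft:B\times A\to B$, $\rightharpoonup:B\times A\to A$, $\leftharpoonup:A\times B\to A$, $\theta:A\times A\to B$ such that $$(a,x)\cdot(b,y)=\big(a\cdot_A b+a\leftharpoonup y+x\rightharpoonup b,\ x\cdot_B y+a\vartriangleright y+x\vartriangleleft b+\theta(a,b)\big)$$ is an associative multiplication on $A\oplus B$. Let $r:B\to A$ be a weak deformation map, i.e. a linear map with $$r(x)\cdot_A r(y)+r(x)\leftharpoonup y+x\rightharpoonup r(y)=r\big(x\cdot_B y+r(x)\vartriangleright y+x\vartriangleleft r(y)+\theta(r(x),r(y))\big)\quad\text{for all }x,y\in B.$$ Let $\mathfrak g=\bigoplus_{n\ge 0}\mathrm{Hom}((A\oplus B)^{\otimes n+1},A\oplus B)$ carry the Gerstenhaber bracket $[f,g]=f\diamond g-(-1)^{pq}g\diamond f$ for $f,g$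 of degrees $p,q$, where $f\diamond g=\sum_{i=0}^{p}(-1)^{iq}f\circ_i g$ and $f\circ_i g$ inserts $g$ into the argument of $f$ with index $i$ (counted from $0$). View $\mathfrak b=\bigoplus_{n\ge0}\mathrm{Hom}(B^{\otimes n+1},A)$, with $\mathfrak b_n=\mathrm{Hom}(B^{\otimes n+1},A)$ in degree $n$, as a graded subspace of $\mathfrak g$, and define $\widetilde\theta,\mu_{\vartriangleright,\vartriangleleft},\nu_{\rightharpoonup,\leftharpoonup}\in\mathfrak g_1$ by $$\widetilde\theta((a,x),(b,y))=(0,\theta(a,b)),\quad \mu_{\vartriangleright,\vartriangleleft}((a,x),(b,y))=(a\cdot_A b,\,a\vartriangleright y+x\vartriangleleft b),\quad \nu_{\rightharpoonup,\leftharpoonup}((a,x),(b,y))=(a\leftharpoonup y+x\rightharpoonup b,\,x\cdot_B y).$$ An $L_\infty$-algebra here has graded symmetric operations $l_k$ of degree $1$, $k\ge1$. It is weakly filtered if there is a descending filtration $F_1\supseteq F_2\supseteq\cdots$ by graded subspaces, with $F_1$ the whole space, for which the space is complete (it is the inverse limit of its quotients by the $F_k$) and $l_k$ takes values in $F_k$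 for all large $k$. Infinite sums converge with respect to such a filtration. A Maurer-Cartan element is an $\alpha$ of degree $0$ with $\sum_{k\ge1}\frac1{k!}l_k(\alpha,\dots,\alpha)=0$, and the twist of $l$ by $\alpha$ has the operations $l_k^\alpha(x_1,\dots,x_k)=\sum_{n\ge0}\frac1{n!}l_{n+k}(\alpha,\dots,\alpha,x_1,\dots,x_k)$. Then the elements $$l_1(f)=[\nu_{\rightharpoonup,\leftharpoonup},f],\qquad l_2(f,g)=[[\mu_{\vartriangleright,\vartriangleleft},f],g],\qquad l_3(f,g,h)=[[[\widetilde\theta,f],g],h]\qquad(f,g,h\in\mathfrak b)$$ lie in $\mathfrak b$, these operations together with $l_k=0$ for $k\ge4$ make $\mathfrak b$ a weakly filtered $L_\infty$-algebra, and $r\in\mathfrak b_0=\mathrm{Hom}(B,A)$ is a Maurer-Cartan element of it. The operations $l_k^r$ obtained by twisting with $r$ are $$l_1^r(f)=l_1(f)+l_2(r,f)+\tfrac12 l_3(r,r,f),\quad l_2^r(f,g)=l_2(f,g)+l_3(r,f,g),\quad l_3^r(f,g,h)=l_3(f,g,h),\quad l_k^r=0\ (k\ge4),$$ and $(\mathfrak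 b,\{l_k^r\}_{k\ge1})$ is a weakly filtered $L_\infty$-algebra. For every linear map $r':B\to A$, the sum $r+r'$ is a weak deformation map if and only if $r'\in\mathfrak b_0$ is a Maurer-Cartan element of $(\mathfrak b,\{l_k^r\}_{k\ge1})$. Finally, for all $n\ge1$ and $f\in\mathfrak b_{n-1}=\mathrm{Hom}(B^{\otimes n},A)$, $$l_1^r(f)=(-1)^{n-1}\delta^r(f),$$ where $\delta^r$ is the Hochschild coboundary $$\delta^r(f)(x_1,\dots,x_{n+1})=x_1\rightharpoonup_r f(x_2,\dots,x_{n+1})+\sum_{i=1}^n(-1)^i f(x_1,\dots,x_i\cdot_r x_{i+1},\dots,x_{n+1})+(-1)^{n+1}f(x_1,\dots,x_n)\leftharpoonup_r x_{n+1}$$ with $$\begin{aligned}x\cdot_r y&=x\cdot_B y+r(x)\vartriangleright y+x\vartriangleleft r(y)+\theta(r(x),r(y)),\\ x\rightharpoonup_r a&=x\rightharpoonup a+r(x)\cdot_A a-r(x\vartriangleleft a)-r(\theta(r(x),a)),\\ a\leftharpoonup_r x&=a\leftharpoonup x+a\cdot_A r(x)-r(a\vartriangleright x)-r(\theta(a,r(x))).\end{aligned}$$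 -/

import Mathlib

open scoped DirectSum

noncomputable section

/-! ### L-infinity algebras (in the convention with graded symmetric operations of degree one) -/

namespace LInfty

variable {K V : Type*} [Field K] [AddCommGroup V] [Module K V]

/-- The Koszul sign `ε(σ)` of the rearrangement `x_{σ 0}, …, x_{σ (k-1)}` of homogeneous elements
`x_0, …, x_{k-1}` of degrees `d 0, …, d (k-1)`: a factor `(-1)^{|x||y|}` for every inverted pair. -/
def koszulSign {k : ℕ} (d : Fin k → ℤ) (σ : Equiv.Perm (Fin k)) : ℤ :=
  ∏ p ∈ (Finset.univ : Finset (Fin k × Fin k)).filter (fun p => p.1 < p.2 ∧ σ p.2 < σ p.1),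
    ((Int.negOnePow (d (σ p.1) * d (σ p.2)) : ℤˣ) : ℤ)

/-- `σ` is an `(i, k - i)`-shuffle: it is increasing on the first `i` and on the last `k - i`
positions. -/
def IsShuffle {k : ℕ} (i : ℕ) (σ : Equiv.Perm (Fin k)) : Prop :=
  ∀ a b : Fin k, a < b → ((b : ℕ) < i ∨ i ≤ (a : ℕ)) → σ a < σ b

open Classical in
/-- A curved `L_∞`-algebra on the graded vector space `V = ⨁ d, 𝒢 d` with operations `l k`. -/
structure IsCurvedLInfinity (𝒢 : ℤ → Submodule K V)
    (l : (k : ℕ) → MultilinearMap K (fun _ : Fin k => V) V) : Prop where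
  graded : DirectSum.IsInternal 𝒢
  degree_one : ∀ (k : ℕ) (d : Fin k → ℤ) (x : Fin k → V), (∀ j, x j ∈ 𝒢 (d j)) →
    l k x ∈ 𝒢 ((∑ j, d j) + 1)
  symmetric : ∀ (k : ℕ) (d : Fin k → ℤ) (x : Fin k → V), (∀ j, x j ∈ 𝒢 (d j)) →
    ∀ σ : Equiv.Perm (Fin k), l k (fun j => x (σ j)) = koszulSign d σ • l k x
  jacobi : ∀ (N : ℕ) (d : Fin N → ℤ) (x : Fin N → V), (∀ j, x j ∈ 𝒢 (d j)) →
    ∑ i : Fin (N + 1),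
      ∑ σ ∈ (Finset.univ : Finset (Equiv.Perm (Fin N))).filter (fun σ => IsShuffle (i : ℕ) σ),
        koszulSign d σ •
          l (N - i + 1)
            (Fin.cons (l i (fun j : Fin i => x (σ ⟨j, by omega⟩)))
              (fun j : Fin (N - i) => x (σ ⟨i + j, by omega⟩))) = 0

/-- An `L_∞`-algebra is a curved one with `l 0 = 0`. -/
structure IsLInfinity (𝒢 : ℤ → Submodule K V)
    (l : (k : ℕ) → MultilinearMap K (fun _ : Fin k => V) V) : Prop
    extends IsCurvedLInfinity 𝒢 l where
  flat : l 0 = 0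

/-- `F 1 ⊇ F 2 ⊇ ⋯` is a filtration which makes the operations `l` weakly filtered: it is a
descending filtration by graded subspaces with `F 1 = V`, every degree is the inverse limit of its
quotients by the filtration, and `l k` takes values in `F k` from some index on
(`F 0` is a dummy, equal to `V`). -/
structure IsWeakFiltration (𝒢 : ℤ → Submodule K V)
    (l : (k : ℕ) → MultilinearMap K (fun _ : Fin k => V) V) (F : ℕ → Submodule K V) : Prop where
  antitone : Antitone F
  first : F 1 = ⊤
  homogeneous : ∀ k, F k ≤ ⨆ d, F k ⊓ 𝒢 d
  complete : ∀ (d : ℤ) (u : ℕ → V), (∀ k, u k ∈ 𝒢 d) → (∀ k, u (k + 1) - u k ∈ F k) →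
    ∃! x : V, x ∈ 𝒢 d ∧ ∀ k, x - u k ∈ F k
  eventually_mem : ∃ N : ℕ, ∀ k, N ≤ k → ∀ x : Fin k → V, l k x ∈ F k

/-- The series `∑ u n` converges to `s` for the topology defined by the filtration `F`. -/
def HasFilteredSum (F : ℕ → Submodule K V) (u : ℕ → V) (s : V) : Prop :=
  ∀ m : ℕ, ∃ n₀ : ℕ, ∀ n, n₀ ≤ n → (∑ j ∈ Finset.range n, u j) - s ∈ F m

/-- `α` is a Maurer-Cartan element: it has degree `0` and `∑_k (1/k!) l_k(α, …, α) = 0`. -/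
def IsMaurerCartan (𝒢 : ℤ → Submodule K V)
    (l : (k : ℕ) → MultilinearMap K (fun _ : Fin k => V) V) (F : ℕ → Submodule K V)
    (α : V) : Prop :=
  α ∈ 𝒢 0 ∧ HasFilteredSum F (fun k => ((Nat.factorial k : K)⁻¹) • l k (fun _ => α)) 0

/-- The operations `l'` are obtained from `l` by twisting with `α`: `l' 0 = 0` and
`l'_k(x_1, …, x_k) = ∑_n (1/n!) l_{n+k}(α, …, α, x_1, …, x_k)` for `k ≥ 1`. -/
def IsTwist (l : (k : ℕ) → MultilinearMap K (fun _ : Fin k => V) V) (F : ℕ → Submodule K V)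
    (α : V) (l' : (k : ℕ) → MultilinearMap K (fun _ : Fin k => V) V) : Prop :=
  l' 0 = 0 ∧ ∀ k : ℕ, 1 ≤ k → ∀ x : Fin k → V,
    HasFilteredSum F
      (fun n => ((Nat.factorial n : K)⁻¹) • l (n + k) (Fin.append (fun _ : Fin n => α) x)) (l' k x)

end LInfty

/-! ### The Gerstenhaber bracket on multilinear maps -/

namespace Gerst

section insertion

variable {K V W : Type*} [Field K] [AddCommGroup V] [Module K V] [AddCommGroup W] [Module K W]

/-- The arguments `(a_0, …, a_{i-1}, g(a_i, …, a_{i+k-1}), a_{i+k}, …)` of `f` in `f ∘_i g`. -/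
def insertArgs {m k N : ℕ} (g : MultilinearMap K (fun _ : Fin k => V) V) (i : Fin m)
    (h : m + k = N + 1) (a : Fin N → V) : Fin m → V := fun j =>
  if _ : (j : ℕ) < i then a ⟨j, by omega⟩
  else if _ : (j : ℕ) = i then g (fun t => a ⟨i + t, by omega⟩)
  else a ⟨j + k - 1, by omega⟩

theorem insertArgs_update_lt {m k N : ℕ} (g : MultilinearMap K (fun _ : Fin k => V) V)
    (i : Fin m) (h : m + k = N + 1) [DecidableEq (Fin N)] (a : Fin N → V) (s : Fin N) (x : V)
    (hs : (s : ℕ) < i) :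
    insertArgs g i h (Function.update a s x) =
      Function.update (insertArgs g i h a) ⟨s, by omega⟩ x := by
  funext j
  simp only [insertArgs, Function.update_apply, Fin.ext_iff]
  have e : ∀ t : Fin k, ¬ ((i : ℕ) + t = s) := fun t => by omega
  simp only [e, if_false]
  split_ifs <;> first | rfl | omega

theorem insertArgs_update_mid {m k N : ℕ} (g : MultilinearMap K (fun _ : Fin k => V) V)
    (i : Fin m) (h : m + k = N + 1) [DecidableEq (Fin N)] (a : Fin N → V) (s : Fin N) (x : V)
    (hs : (i : ℕ) ≤ s) (hs' : (s : ℕ) < i + k) :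
    insertArgs g i h (Function.update a s x) =
      Function.update (insertArgs g i h a) i
        (g (Function.update (fun t : Fin k => a ⟨i + t, by omega⟩) ⟨s - i, by omega⟩ x)) := by
  funext j
  simp only [insertArgs, Function.update_apply, Fin.ext_iff]
  split_ifs
  all_goals first
    | rfl
    | omega
    | (congr 1; funext t; simp only [Function.update_apply, Fin.ext_iff]; congr 1
       apply propext; constructor <;> intro <;> omega)

theorem insertArgs_update_gt {m k N : ℕ} (g : MultilinearMap K (fun _ : Fin k => V) V)
    (i : Fin m) (h : m + k = N + 1) [DecidableEq (Fin N)] (a : Fin N → V) (s : Fin N) (x : V)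
    (hs : (i : ℕ) + k ≤ s) :
    insertArgs g i h (Function.update a s x) =
      Function.update (insertArgs g i h a) ⟨s + 1 - k, by omega⟩ x := by
  funext j
  simp only [insertArgs, Function.update_apply, Fin.ext_iff]
  have e : ∀ t : Fin k, ¬ ((i : ℕ) + t = s) := fun t => by omega
  simp only [e, if_false]
  split_ifs <;> first | rfl | omega

/-- The partial composition `f ∘_i g`,
`(a_0, a_1, …) ↦ f(a_0, …, a_{i-1}, g(a_i, …, a_{i+k-1}), a_{i+k}, …)`, with `i` counted from `0`. -/
def insertion {m k N : ℕ} (f : MultilinearMap K (fun _ : Fin m => V) W)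
    (g : MultilinearMap K (fun _ : Fin k => V) V) (i : Fin m) (h : m + k = N + 1) :
    MultilinearMap K (fun _ : Fin N => V) W where
  toFun a := f (insertArgs g i h a)
  map_update_add' a s x y := by
    rcases lt_or_ge (s : ℕ) i with hs | hs
    · simp only [insertArgs_update_lt g i h a s _ hs, MultilinearMap.map_update_add]
    rcases lt_or_ge (s : ℕ) (i + k) with hs' | hs'
    · simp only [insertArgs_update_mid g i h a s _ hs hs', MultilinearMap.map_update_add]
    · simp only [insertArgs_update_gt g i h a s _ hs', MultilinearMap.map_update_add]
  map_update_smul' a s c x := by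
    rcases lt_or_ge (s : ℕ) i with hs | hs
    · simp only [insertArgs_update_lt g i h a s _ hs, MultilinearMap.map_update_smul]
    rcases lt_or_ge (s : ℕ) (i + k) with hs' | hs'
    · simp only [insertArgs_update_mid g i h a s _ hs hs', MultilinearMap.map_update_smul]
    · simp only [insertArgs_update_gt g i h a s _ hs', MultilinearMap.map_update_smul]

theorem insertArgs_change {m k N : ℕ} (g g' : MultilinearMap K (fun _ : Fin k => V) V)
    (i : Fin m) (h : m + k = N + 1) (a : Fin N → V) :
    insertArgs g' i h a =
      Function.update (insertArgs g i h a) i (g' (fun t => a ⟨i + t, by omega⟩)) := by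
  funext j
  simp only [insertArgs, Function.update_apply, Fin.ext_iff]
  split_ifs <;> first | rfl | omega

/-- `f ∘_i g` is bilinear in `(f, g)`. -/
def insertionₗ {m k N : ℕ} (i : Fin m) (h : m + k = N + 1) :
    MultilinearMap K (fun _ : Fin m => V) W →ₗ[K] MultilinearMap K (fun _ : Fin k => V) V →ₗ[K]
      MultilinearMap K (fun _ : Fin N => V) W :=
  LinearMap.mk₂ K (fun f g => insertion f g i h)
    (fun _ _ _ => rfl) (fun _ _ _ => rfl)
    (fun f g g' => by
      ext a
      change f (insertArgs (g + g') i h a) = f (insertArgs g i h a) + f (insertArgs g' i h a)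
      rw [insertArgs_change 0 (g + g'), insertArgs_change 0 g, insertArgs_change 0 g',
        add_apply, MultilinearMap.map_update_add])
    (fun c f g => by
      ext a
      change f (insertArgs (c • g) i h a) = c • f (insertArgs g i h a)
      rw [insertArgs_change 0 (c • g), insertArgs_change 0 g,
        smul_apply, MultilinearMap.map_update_smul])

end insertion

/-- The graded vector space `⨁_{n ≥ 0} Hom(V^{⊗ n+1}, W)`; the `n`-th summand has degree `n`. -/
def GradedHom (K V W : Type*) [Field K] [AddCommGroup V] [Module K V] [AddCommGroup W]
    [Module K W] : Type _ :=
  ⨁ n : ℕ, MultilinearMap K (fun _ : Fin (n + 1) => V) W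

namespace GradedHom

variable (K V W : Type*) [Field K] [AddCommGroup V] [Module K V] [AddCommGroup W] [Module K W]

instance instAddCommGroup : AddCommGroup (GradedHom K V W) :=
  inferInstanceAs (AddCommGroup (⨁ n : ℕ, MultilinearMap K (fun _ : Fin (n + 1) => V) W))

instance instModule : Module K (GradedHom K V W) :=
  inferInstanceAs (Module K (⨁ n : ℕ, MultilinearMap K (fun _ : Fin (n + 1) => V) W))

/-- The inclusion of the summand `Hom(V^{⊗ n+1}, W)`. -/
def of (n : ℕ) : MultilinearMap K (fun _ : Fin (n + 1) => V) W →ₗ[K] GradedHom K V W :=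
  DirectSum.lof K ℕ (fun n => MultilinearMap K (fun _ : Fin (n + 1) => V) W) n

variable {K V W}

/-- The linear map on the direct sum with given restrictions to the summands. -/
def lift {X : Type*} [AddCommGroup X] [Module K X]
    (c : (n : ℕ) → MultilinearMap K (fun _ : Fin (n + 1) => V) W →ₗ[K] X) :
    GradedHom K V W →ₗ[K] X :=
  DirectSum.toModule K ℕ X c

theorem lift_of {X : Type*} [AddCommGroup X] [Module K X]
    (c : (n : ℕ) → MultilinearMap K (fun _ : Fin (n + 1) => V) W →ₗ[K] X) (n : ℕ)
    (f : MultilinearMap K (fun _ : Fin (n + 1) => V) W) : lift c (of K V W n f) = c n f :=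
  DirectSum.toModule_lof (M := fun n : ℕ => MultilinearMap K (fun _ : Fin (n + 1) => V) W)
    (φ := c) K n f

end GradedHom

variable (K V : Type*) [Field K] [AddCommGroup V] [Module K V]

/-- `f ⋄ g = ∑_i (-1)^{i q} f ∘_i g` for `f` of degree `p` and `g` of degree `q`
(so `f` has `p + 1` and `g` has `q + 1` arguments, and `i` runs from `0` to `p`). -/
def diamond (p q : ℕ) :
    MultilinearMap K (fun _ : Fin (p + 1) => V) V →ₗ[K]
      MultilinearMap K (fun _ : Fin (q + 1) => V) V →ₗ[K]
        MultilinearMap K (fun _ : Fin (p + q + 1) => V) V :=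
  ∑ i : Fin (p + 1), ((-1 : K) ^ ((i : ℕ) * q)) • insertionₗ i (by omega)

/-- The Gerstenhaber bracket `[f, g] = f ⋄ g - (-1)^{p q} g ⋄ f` on homogeneous elements of
degrees `p` and `q`. -/
def homogeneousBracket (p q : ℕ) :
    MultilinearMap K (fun _ : Fin (p + 1) => V) V →ₗ[K]
      MultilinearMap K (fun _ : Fin (q + 1) => V) V →ₗ[K] GradedHom K V V :=
  (diamond K V p q).compr₂ (GradedHom.of K V V (p + q))
    - ((-1 : K) ^ (p * q)) • ((diamond K V q p).compr₂ (GradedHom.of K V V (q + p))).flip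

/-- The Gerstenhaber bracket, extended bilinearly to `⨁_n Hom(V^{⊗ n+1}, V)`. -/
def bracket : GradedHom K V V →ₗ[K] GradedHom K V V →ₗ[K] GradedHom K V V :=
  GradedHom.lift fun p => (GradedHom.lift fun q => (homogeneousBracket K V p q).flip).flip

end Gerst

/-! ### Quasi-twilled associative algebras and weak deformation maps -/

/-- A bilinear map, as a multilinear map in two variables. -/
def bilinToMultilin {K V W : Type*} [Field K] [AddCommGroup V] [Module K V] [AddCommGroup W]
    [Module K W] (β : V →ₗ[K] V →ₗ[K] W) : MultilinearMap K (fun _ : Fin 2 => V) W :=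
  MultilinearMap.mk' (fun x => β (x 0) (x 1))
    (fun x i y z => by fin_cases i <;> simp)
    (fun x i c y => by fin_cases i <;> simp)

/-- A quasi-twilled associative algebra `(A_μ, B_ν, ▷, ◁, ⇀, ↼, θ)`: an associative algebra
structure on `A ⊕ B` for which `B` is a subalgebra, written in components. -/
structure QuasiTwilled (K A B : Type*) [Field K] [AddCommGroup A] [Module K A]
    [AddCommGroup B] [Module K B] where
  /-- `μ(a, b) = a ·_A b` -/
  mulA : A →ₗ[K] A →ₗ[K] A
  /-- `ν(x, y) = x ·_B y` -/
  mulB : B →ₗ[K] B →ₗ[K] B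
  /-- `a ▷ x` -/
  tri : A →ₗ[K] B →ₗ[K] B
  /-- `x ◁ a` -/
  ltri : B →ₗ[K] A →ₗ[K] B
  /-- `x ⇀ a` -/
  rharp : B →ₗ[K] A →ₗ[K] A
  /-- `a ↼ x` -/
  lharp : A →ₗ[K] B →ₗ[K] A
  /-- `θ(a, b)` -/
  theta : A →ₗ[K] A →ₗ[K] B
  assocB : ∀ x y z, mulB (mulB x y) z = mulB x (mulB y z)
  bimod_left : ∀ x y a, rharp (mulB x y) a = rharp x (rharp y a)
  bimod_mid : ∀ x a y, lharp (rharp x a) y = rharp x (lharp a y)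
  bimod_right : ∀ a x y, lharp (lharp a x) y = lharp a (mulB x y)
  compat1 : ∀ a b c, mulA a (mulA b c) + lharp a (theta b c)
    = mulA (mulA a b) c + rharp (theta a b) c
  compat2 : ∀ a b x, tri (mulA a b) x + mulB (theta a b) x
    = tri a (tri b x) + theta a (lharp b x)
  compat3 : ∀ x a b, ltri x (mulA a b) + mulB x (theta a b)
    = ltri (ltri x a) b + theta (rharp x a) b
  compat4 : ∀ a x b, tri a (ltri x b) + theta a (rharp x b)
    = ltri (tri a x) b + theta (lharp a x) b
  compat5 : ∀ a x y, tri a (mulB x y) = mulB (tri a x) y + tri (lharp a x) y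
  compat6 : ∀ x y a, ltri (mulB x y) a = mulB x (ltri y a) + ltri x (rharp y a)
  compat7 : ∀ x a y, ltri x (lharp a y) + mulB x (tri a y)
    = tri (rharp x a) y + mulB (ltri x a) y
  compat8 : ∀ x a b, rharp x (mulA a b) = mulA (rharp x a) b + rharp (ltri x a) b
  compat9 : ∀ a b x, lharp (mulA a b) x = mulA a (lharp b x) + lharp a (tri b x)
  compat10 : ∀ a x b, lharp a (ltri x b) + mulA a (rharp x b)
    = rharp (tri a x) b + mulA (lharp a x) b
  compat11 : ∀ a b c, theta a (mulA b c) + tri a (theta b c)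
    = theta (mulA a b) c + ltri (theta a b) c

/-- The graded vector space `𝔟 = ⨁_{n ≥ 0} Hom(B^{⊗ n+1}, A)`. -/
abbrev BSpace (K A B : Type*) [Field K] [AddCommGroup A] [Module K A]
    [AddCommGroup B] [Module K B] : Type _ :=
  Gerst.GradedHom K B A

/-- The graded vector space `𝔤 = ⨁_{n ≥ 0} Hom((A ⊕ B)^{⊗ n+1}, A ⊕ B)`. -/
abbrev GSpace (K A B : Type*) [Field K] [AddCommGroup A] [Module K A]
    [AddCommGroup B] [Module K B] : Type _ :=
  Gerst.GradedHom K (A × B) (A × B)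

namespace BSpace

variable (K A B : Type*) [Field K] [AddCommGroup A] [Module K A] [AddCommGroup B] [Module K B]

/-- The grading of `𝔟`: `Hom(B^{⊗ n+1}, A)` in degree `n ≥ 0`, and `0` in negative degrees. -/
def grading (d : ℤ) : Submodule K (BSpace K A B) :=
  ⨆ (n : ℕ) (_ : (n : ℤ) = d), LinearMap.range (Gerst.GradedHom.of K B A n)

/-- The inclusion of `𝔟` in `𝔤`: a map `f` is sent to
`((a_0, x_0), …, (a_n, x_n)) ↦ (f(x_0, …, x_n), 0)`. -/
def incl : BSpace K A B →ₗ[K] GSpace K A B :=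
  Gerst.GradedHom.lift fun n =>
    (Gerst.GradedHom.of K _ _ n) ∘ₗ (LinearMap.compMultilinearMapₗ K (LinearMap.inl K A B)) ∘ₗ
      (MultilinearMap.compLinearMapₗ (fun _ : Fin (n + 1) => LinearMap.snd K A B))

/-- The projection `P : 𝔤 → 𝔟`: restrict all arguments to `B` and take the `A`-component. -/
def proj : GSpace K A B →ₗ[K] BSpace K A B :=
  Gerst.GradedHom.lift fun n =>
    (Gerst.GradedHom.of K _ _ n) ∘ₗ (LinearMap.compMultilinearMapₗ K (LinearMap.fst K A B)) ∘ₗ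
      (MultilinearMap.compLinearMapₗ (fun _ : Fin (n + 1) => LinearMap.inr K A B))

/-- The iterated bracket `Δ ↦ ((f_1, …, f_k) ↦ [⋯[[Δ, f_1], f_2], …, f_k])` with entries in `𝔟`. -/
def iteratedBracket : (k : ℕ) → GSpace K A B →ₗ[K]
    MultilinearMap K (fun _ : Fin k => BSpace K A B) (GSpace K A B)
  | 0 => (MultilinearMap.constLinearEquivOfIsEmpty K K _ _).toLinearMap
  | k + 1 =>
    (multilinearCurryLeftEquiv K (fun _ : Fin (k + 1) => BSpace K A B)
        (GSpace K A B)).symm.toLinearMap ∘ₗ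
      (((Gerst.bracket K (A × B)).compl₂ (incl K A B)).compr₂ (iteratedBracket k))

variable {K A B}

/-- A linear map `r : B → A` as an element of `𝔟_0`. -/
def ofLinear (r : B →ₗ[K] A) : BSpace K A B :=
  Gerst.GradedHom.of K B A 0 (MultilinearMap.ofSubsingleton K B A (0 : Fin 1) r)

end BSpace

namespace QuasiTwilled

variable {K A B : Type*} [Field K] [AddCommGroup A] [Module K A] [AddCommGroup B] [Module K B]
variable (Q : QuasiTwilled K A B)

/-- `θ~((a, x), (b, y)) = (0, θ(a, b))`, an element of `𝔤_1`. -/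
def thetaElt : GSpace K A B :=
  Gerst.GradedHom.of K (A × B) (A × B) 1
    (bilinToMultilin ((Q.theta.compl₁₂ (LinearMap.fst K A B) (LinearMap.fst K A B)).compr₂
      (LinearMap.inr K A B)))

/-- `μ_{▷,◁}((a, x), (b, y)) = (a ·_A b, a ▷ y + x ◁ b)`, an element of `𝔤_1`. -/
def muElt : GSpace K A B :=
  Gerst.GradedHom.of K (A × B) (A × B) 1
    (bilinToMultilin
      ((Q.mulA.compl₁₂ (LinearMap.fst K A B) (LinearMap.fst K A B)).compr₂ (LinearMap.inl K A B)
      + (Q.tri.compl₁₂ (LinearMap.fst K A B) (LinearMap.snd K A B)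
        + Q.ltri.compl₁₂ (LinearMap.snd K A B) (LinearMap.fst K A B)).compr₂
          (LinearMap.inr K A B)))

/-- `ν_{⇀,↼}((a, x), (b, y)) = (a ↼ y + x ⇀ b, x ·_B y)`, an element of `𝔤_1`. -/
def nuElt : GSpace K A B :=
  Gerst.GradedHom.of K (A × B) (A × B) 1
    (bilinToMultilin
      ((Q.lharp.compl₁₂ (LinearMap.fst K A B) (LinearMap.snd K A B)
        + Q.rharp.compl₁₂ (LinearMap.snd K A B) (LinearMap.fst K A B)).compr₂
          (LinearMap.inl K A B)
      + (Q.mulB.compl₁₂ (LinearMap.snd K A B) (LinearMap.snd K A B)).compr₂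
          (LinearMap.inr K A B)))

/-- The operations of the controlling algebra on `𝔟`: `l_1(f) = [ν, f]`, `l_2(f, g) = [[μ, f], g]`,
`l_3(f, g, h) = [[[θ~, f], g], h]`, and `l_k = 0` for `k ≠ 1, 2, 3`. The brackets are taken in `𝔤`;
the projection to `𝔟` only serves to view the result as an element of `𝔟`. -/
def l : (k : ℕ) → MultilinearMap K (fun _ : Fin k => BSpace K A B) (BSpace K A B)
  | 1 => (BSpace.proj K A B).compMultilinearMap (BSpace.iteratedBracket K A B 1 Q.nuElt)
  | 2 => (BSpace.proj K A B).compMultilinearMap (BSpace.iteratedBracket K A B 2 Q.muElt)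
  | 3 => (BSpace.proj K A B).compMultilinearMap (BSpace.iteratedBracket K A B 3 Q.thetaElt)
  | _ => 0

/-- `r : B → A` is a weak deformation map. -/
def IsWeakDeformationMap (r : B →ₗ[K] A) : Prop :=
  ∀ x y : B, Q.mulA (r x) (r y) + Q.lharp (r x) y + Q.rharp x (r y)
    = r (Q.mulB x y + Q.tri (r x) y + Q.ltri x (r y) + Q.theta (r x) (r y))

/-- `x ·_r y = x ·_B y + r(x) ▷ y + x ◁ r(y) + θ(r(x), r(y))`. -/
def mulBr (r : B →ₗ[K] A) : B →ₗ[K] B →ₗ[K] B :=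
  Q.mulB + Q.tri.compl₁₂ r LinearMap.id + Q.ltri.compl₁₂ LinearMap.id r + Q.theta.compl₁₂ r r

/-- `x ⇀_r a = x ⇀ a + r(x) ·_A a - r(x ◁ a) - r(θ(r(x), a))`. -/
def rharpr (r : B →ₗ[K] A) : B →ₗ[K] A →ₗ[K] A :=
  Q.rharp + Q.mulA.compl₁₂ r LinearMap.id - Q.ltri.compr₂ r
    - (Q.theta.compl₁₂ r LinearMap.id).compr₂ r

/-- `a ↼_r x = a ↼ x + a ·_A r(x) - r(a ▷ x) - r(θ(a, r(x)))`. -/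
def lharpr (r : B →ₗ[K] A) : A →ₗ[K] B →ₗ[K] A :=
  Q.lharp + Q.mulA.compl₁₂ LinearMap.id r - Q.tri.compr₂ r
    - (Q.theta.compl₁₂ LinearMap.id r).compr₂ r

/-- The Hochschild coboundary of `B_r = (B, ·_r)` with coefficients in `(A, ⇀_r, ↼_r)`:
`δ^r(f)(x_1, …, x_{n+1}) = x_1 ⇀_r f(x_2, …, x_{n+1})
  + ∑_{i=1}^n (-1)^i f(x_1, …, x_i ·_r x_{i+1}, …, x_{n+1})
  + (-1)^{n+1} f(x_1, …, x_n) ↼_r x_{n+1}`. -/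
def delta (r : B →ₗ[K] A) {n : ℕ} (f : MultilinearMap K (fun _ : Fin n => B) A) :
    MultilinearMap K (fun _ : Fin (n + 1) => B) A :=
  LinearMap.uncurryLeft (M := fun _ : Fin (n + 1) => B)
      { toFun := fun x => (Q.rharpr r x).compMultilinearMap f
        map_add' := fun x y => by ext; simp
        map_smul' := fun c x => by ext; simp }
    + ∑ i : Fin n, ((-1 : K) ^ ((i : ℕ) + 1)) •
        Gerst.insertion f (bilinToMultilin (Q.mulBr r)) i (by omega)
    + ((-1 : K) ^ (n + 1)) •
        MultilinearMap.uncurryRight (M := fun _ : Fin (n + 1) => B)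
          ((Q.lharpr r).compMultilinearMap f)

end QuasiTwilled

end

/-! The operations on `𝔟` are Voronov's higher derived brackets. The Gerstenhaber bracket makes `𝔤`
a graded Lie algebra (`bracket_leibniz_of`), `𝔟` is an abelian subalgebra, and the kernel of `proj`
consists of the sums of maps for which `B` is closed, hence is a subalgebra (`isVoronovData`).
Associativity of the product on `A × B` says that `Δ = ν + μ + θ~` satisfies `[Δ, Δ] = 0`, so `f_1,
…, f_k ↦ proj [⋯[Δ, f_1], …, f_k]` is a curved `L_∞`-structure (`IsVoronovData.isCurvedLInfinity`).

A weight separates the three summands of `Δ`. With `A` in degree `1` and `B` in degree `0`, the maps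
`ν`, `μ`, `θ~` lower the degree by `0`, `1`, `2`, elements of `𝔟` have weight `-1`, weights add
under the bracket, and `proj` kills every weight other than `-1`. So only `ν` contributes to `l 1`,
`μ` to `l 2`, `θ~` to `l 3`, and nothing to the others (`l_eq_proj_nested`). In weight `-1` nothing
is lost by projecting, so the brackets themselves lie in `𝔟`.

For the twist no second `L_∞` argument is needed. Conjugating the product by `(a, x) ↦ (a + r(x),
x)` keeps `B` a subalgebra exactly when `r` is a weak deformation map, and so yields another
quasi-twilled algebra `twist hr`. Its `ν`, `μ`, `θ~` are the weight components of `exp([·, r])Δ`, so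
its controlling algebra is the twist of that of `Q` by `r`. All claims on the twisted operations are
thus the claims for `Q`, applied to `twist hr`: its weak deformation maps are the `s` with `r + s` a
weak deformation map of `Q`, and its `l 1`, written out, is the Hochschild coboundary up to sign. -/

/-! ### Signs. -/

/-- The sign `(-1)^n`. -/
def parity (n : ℤ) : ℤ := ((Int.negOnePow n : ℤˣ) : ℤ)

theorem parity_add (m n : ℤ) : parity (m + n) = parity m * parity n := by
  simp [parity, Int.negOnePow_add]

theorem parity_eq_of_even_sub {m n : ℤ} (h : Even (m - n)) : parity m = parity n := by
  simp only [parity, (Int.negOnePow_eq_iff m n).2 h]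

theorem parity_zero : parity 0 = 1 := by simp [parity]

theorem parity_mul_self (n : ℤ) : parity n * parity n = 1 := by
  rw [← parity_add, ← parity_zero]
  exact parity_eq_of_even_sub ⟨n, by ring⟩

theorem parity_smul_smul {M : Type*} [AddCommGroup M] (m n : ℤ) (x : M) :
    parity m • parity n • x = parity (m + n) • x := by
  rw [smul_smul, parity_add]

theorem parity_natCast_smul {K M : Type*} [Field K] [AddCommGroup M] [Module K M] (n : ℕ)
    (x : M) : parity n • x = ((-1 : K) ^ n) • x := by
  rcases Nat.even_or_odd n with h | h
  · have : parity n = 1 := by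
      simp [parity, Int.negOnePow_even _ ((Int.even_coe_nat n).2 h)]
    rw [this, h.neg_one_pow, one_smul, one_smul]
  · have : parity n = -1 := by
      simp [parity, Int.negOnePow_odd _ ((Int.odd_coe_nat n).2 h)]
    rw [this, h.neg_one_pow, neg_smul, neg_smul, one_smul, one_smul]

/-! ### Partial compositions and the pre-Lie identity. -/

namespace Gerst

section sequences

/-- The sequence `a_0, …, a_{i-1}, G(a_i, a_{i+1}, …), a_{i+q+1}, …`. -/
def insertSeq {V : Type*} (q i : ℕ) (G : (ℕ → V) → V) (a : ℕ → V) : ℕ → V := fun j =>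
  if j < i then a j else if j = i then G (fun t => a (i + t)) else a (j + q)

/-- The bound `j ≤ q` places `H` among the `q + 1` entries consumed by `G`, so the two insertions
are nested. -/
theorem insertSeq_insertSeq_mid {V : Type*} (q r i j : ℕ) (hj : j ≤ q) (G H : (ℕ → V) → V) (a : ℕ → V) :
    insertSeq q i G (insertSeq r (i + j) H a)
      = insertSeq (q + r) i (fun b => G (insertSeq r j H b)) a := by
  funext m
  simp only [insertSeq]
  rcases lt_trichotomy m i with h | rfl | h
  · rw [if_pos h, if_pos (by omega), if_pos h]
  · simp only [lt_irrefl, if_false, if_true]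
    congr 1
    funext t
    simp only [Nat.add_lt_add_iff_left, Nat.add_right_inj, Nat.add_assoc]
    rfl
  · rw [if_neg (by omega), if_neg (by omega), if_neg (by omega), if_neg (by omega),
      if_neg (by omega), if_neg (by omega)]
    congr 1; omega

variable {K V W : Type*} [Field K] [AddCommGroup V] [Module K V] [AddCommGroup W] [Module K W]

/-- A multilinear map in `n` variables, evaluated on the first `n` terms of a sequence. -/
def evalSeq {n : ℕ} (f : MultilinearMap K (fun _ : Fin n => V) W) (a : ℕ → V) : W :=
  f fun t => a t

theorem evalSeq_congr {n : ℕ} (f : MultilinearMap K (fun _ : Fin n => V) W) {a b : ℕ → V}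
    (h : ∀ t < n, a t = b t) : evalSeq f a = evalSeq f b :=
  congrArg f (funext fun t => h t t.2)

/-- Infinite sequences lose nothing, since a tuple extends by `0`, and they take arities out of the
types: maps with `p + (q + r)` and `p + q + r` inputs can be compared without casts. -/
theorem ext_evalSeq {n : ℕ} {f g : MultilinearMap K (fun _ : Fin n => V) W}
    (h : ∀ a, evalSeq f a = evalSeq g a) : f = g := by
  ext a
  have := h fun t => if ht : t < n then a ⟨t, ht⟩ else 0
  simpa [evalSeq] using this

theorem evalSeq_insertion {m q N : ℕ} (f : MultilinearMap K (fun _ : Fin m => V) W)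
    (g : MultilinearMap K (fun _ : Fin (q + 1) => V) V) (i : Fin m) (h : m + (q + 1) = N + 1)
    (a : ℕ → V) : evalSeq (insertion f g i h) a = evalSeq f (insertSeq q i (evalSeq g) a) := by
  change f _ = f _
  congr 1

theorem evalSeq_sum {n : ℕ} {ι : Type*} (s : Finset ι)
    (f : ι → MultilinearMap K (fun _ : Fin n => V) W) (a : ℕ → V) :
    evalSeq (∑ i ∈ s, f i) a = ∑ i ∈ s, evalSeq (f i) a := by
  simp [evalSeq]

theorem evalSeq_smul {n : ℕ} (c : K) (f : MultilinearMap K (fun _ : Fin n => V) W) (a : ℕ → V) :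
    evalSeq (c • f) a = c • evalSeq f a := rfl

/-- Insertions at different places commute, up to the shift of the right one by `r`. Here `h` has to
be a map of finite arity: it reads only the entries `j, …, j + r`, all to the left of `i + r`. -/
theorem insertSeq_insertSeq_lt (q r i j : ℕ) (hij : j < i) (G : (ℕ → V) → V)
    (h : MultilinearMap K (fun _ : Fin (r + 1) => V) V) (a : ℕ → V) :
    insertSeq q i G (insertSeq r j (evalSeq h) a)
      = insertSeq r j (evalSeq h) (insertSeq q (i + r) G a) := by
  have e : evalSeq h (fun t => insertSeq q (i + r) G a (j + t)) = evalSeq h (fun t => a (j + t)) :=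
    evalSeq_congr h fun t ht => by simp only [insertSeq]; rw [if_pos (by omega)]
  funext m
  simp only [insertSeq] at e ⊢
  rw [e]
  rcases lt_trichotomy m j with h | rfl | h
  · rw [if_pos (by omega), if_pos h, if_pos h, if_pos (by omega)]
  · simp [hij]
  · rcases lt_trichotomy m i with h' | rfl | h'
    · rw [if_pos h', if_neg (by omega), if_neg (by omega), if_neg (by omega), if_neg (by omega),
        if_pos (by omega)]
    · simp only [lt_irrefl, if_false, if_true]
      rw [if_neg (by omega), if_neg (by omega)]
      congr 1
      funext t
      rw [if_neg (by omega), if_neg (by omega)]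
      congr 1; omega
    · rw [if_neg (by omega), if_neg (by omega), if_neg (by omega), if_neg (by omega),
        if_neg (by omega), if_neg (by omega), if_neg (by omega), if_neg (by omega)]
      congr 1; omega

theorem sum_range_triangle {M : Type*} [AddCommMonoid M] (H : ℕ → ℕ → M) (p : ℕ) :
    ∑ i ∈ Finset.range (p + 1), ∑ j ∈ Finset.range (p - i), H i (i + 1 + j)
      = ∑ i ∈ Finset.range (p + 1), ∑ j ∈ Finset.range i, H j i := by
  induction p with
  | zero => simp
  | succ p ih =>
    rw [Finset.sum_range_succ, Finset.sum_range_succ _ (p + 1), ← ih]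
    simp only [Nat.sub_self, Finset.range_zero, Finset.sum_empty, add_zero]
    rw [← Finset.sum_add_distrib]
    refine Finset.sum_congr rfl fun i hi => ?_
    have hi' := Finset.mem_range.1 hi
    rw [show p + 1 - i = p - i + 1 by omega, Finset.sum_range_succ,
      show i + 1 + (p - i) = p + 1 by omega]

theorem sum_range_split {M : Type*} [AddCommMonoid M] (G : ℕ → M) (p q i : ℕ) (hi : i ≤ p) :
    ∑ j ∈ Finset.range (p + q + 1), G j
      = ∑ j ∈ Finset.range i, G j + ∑ j ∈ Finset.range (q + 1), G (i + j)
        + ∑ j ∈ Finset.range (p - i), G (i + 1 + j + q) := by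
  rw [show p + q + 1 = i + (q + 1) + (p - i) by omega, Finset.sum_range_add,
    Finset.sum_range_add]
  congr 1
  refine Finset.sum_congr rfl fun j _ => ?_
  congr 1; omega

end sequences

section preLie

variable {K V : Type*} [Field K] [AddCommGroup V] [Module K V]

theorem diamond_apply (p q : ℕ) (f : MultilinearMap K (fun _ : Fin (p + 1) => V) V)
    (g : MultilinearMap K (fun _ : Fin (q + 1) => V) V) :
    diamond K V p q f g
      = ∑ i : Fin (p + 1), ((-1 : K) ^ ((i : ℕ) * q)) • insertion f g i (by omega) := by
  simp only [diamond, LinearMap.sum_apply, LinearMap.smul_apply]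
  rfl

theorem evalSeq_diamond (p q : ℕ) (f : MultilinearMap K (fun _ : Fin (p + 1) => V) V)
    (g : MultilinearMap K (fun _ : Fin (q + 1) => V) V) (a : ℕ → V) :
    evalSeq (diamond K V p q f g) a
      = ∑ i ∈ Finset.range (p + 1),
          ((-1 : K) ^ (i * q)) • evalSeq f (insertSeq q i (evalSeq g) a) := by
  rw [diamond_apply, evalSeq_sum, Finset.sum_range]
  simp only [evalSeq_smul, evalSeq_insertion]

/-- The terms of `(f ⋄ g) ⋄ h` in which `g` and `h` are inserted in different arguments of `f`,
`g` to the left of `h`. -/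
def disjointSum (p q r : ℕ) (f : MultilinearMap K (fun _ : Fin (p + 1) => V) V)
    (g : MultilinearMap K (fun _ : Fin (q + 1) => V) V)
    (h : MultilinearMap K (fun _ : Fin (r + 1) => V) V) (a : ℕ → V) : V :=
  ∑ i ∈ Finset.range (p + 1), ∑ j ∈ Finset.range i,
    ((-1 : K) ^ (i * r + j * q)) •
      evalSeq f (insertSeq r i (evalSeq h) (insertSeq q j (evalSeq g) a))

theorem evalSeq_diamond_diamond_right (p q r : ℕ)
    (f : MultilinearMap K (fun _ : Fin (p + 1) => V) V)
    (g : MultilinearMap K (fun _ : Fin (q + 1) => V) V)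
    (h : MultilinearMap K (fun _ : Fin (r + 1) => V) V) (a : ℕ → V) :
    evalSeq (diamond K V p (q + r) f (diamond K V q r g h)) a
      = ∑ i ∈ Finset.range (p + 1), ∑ j ∈ Finset.range (q + 1),
          ((-1 : K) ^ (i * (q + r) + j * r)) •
            evalSeq f (insertSeq (q + r) i
              (fun b => evalSeq g (insertSeq r j (evalSeq h) b)) a) := by
  have e : ∀ i : Fin (p + 1),
      insertion f (diamond K V q r g h) i (show p + 1 + (q + r + 1) = p + (q + r) + 1 + 1 by omega)
        = ∑ j : Fin (q + 1), ((-1 : K) ^ ((j : ℕ) * r)) •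
            insertion f (insertion g h j (show q + 1 + (r + 1) = q + r + 1 + 1 by omega)) i
              (show p + 1 + (q + r + 1) = p + (q + r) + 1 + 1 by omega) := fun i => by
    change insertionₗ i _ f _ = ∑ j, _ • insertionₗ i _ f _
    simp only [diamond_apply, map_sum, map_smul]
  rw [diamond_apply, evalSeq_sum, Finset.sum_range]
  refine Finset.sum_congr rfl fun i _ => ?_
  rw [e, evalSeq_smul, evalSeq_sum, Finset.sum_range, Finset.smul_sum]
  refine Finset.sum_congr rfl fun j _ => ?_
  rw [evalSeq_smul, smul_smul, ← pow_add, evalSeq_insertion]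
  congr 3

/-- In `(f ⋄ g) ⋄ h` the map `h` enters to the left of `g`, inside `g`, or to its right. The inner
terms are `f ⋄ (g ⋄ h)`. The outer ones are, up to the factor `(-1)^(q * r)`, symmetric in `g` and
`h`, which is the graded pre-Lie identity. -/
theorem evalSeq_associator (p q r : ℕ)
    (f : MultilinearMap K (fun _ : Fin (p + 1) => V) V)
    (g : MultilinearMap K (fun _ : Fin (q + 1) => V) V)
    (h : MultilinearMap K (fun _ : Fin (r + 1) => V) V) (a : ℕ → V) :
    evalSeq (diamond K V (p + q) r (diamond K V p q f g) h) a
      = evalSeq (diamond K V p (q + r) f (diamond K V q r g h)) a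
        + (disjointSum p r q f h g a + ((-1 : K) ^ (q * r)) • disjointSum p q r f g h a) := by
  rw [evalSeq_diamond]
  simp only [evalSeq_diamond p q f g, Finset.smul_sum, smul_smul, ← pow_add]
  rw [Finset.sum_comm, evalSeq_diamond_diamond_right]
  simp only [disjointSum]
  rw [← sum_range_triangle (fun j i => ((-1 : K) ^ (i * r + j * q)) •
    evalSeq f (insertSeq r i (evalSeq h) (insertSeq q j (evalSeq g) a))), Finset.smul_sum,
    ← Finset.sum_add_distrib, ← Finset.sum_add_distrib]
  refine Finset.sum_congr rfl fun i hi => ?_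
  have hi' := Finset.mem_range.1 hi
  rw [sum_range_split _ p q i (by omega), Finset.smul_sum]
  have e1 : ∀ j ∈ Finset.range i, ((-1 : K) ^ (j * r + i * q)) •
        evalSeq f (insertSeq q i (evalSeq g) (insertSeq r j (evalSeq h) a))
      = ((-1 : K) ^ (i * q + j * r)) •
        evalSeq f (insertSeq q i (evalSeq g) (insertSeq r j (evalSeq h) a)) := fun j _ => by
    rw [add_comm]
  have e2 : ∀ j ∈ Finset.range (q + 1), ((-1 : K) ^ ((i + j) * r + i * q)) •
        evalSeq f (insertSeq q i (evalSeq g) (insertSeq r (i + j) (evalSeq h) a))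
      = ((-1 : K) ^ (i * (q + r) + j * r)) •
        evalSeq f (insertSeq (q + r) i
          (fun b => evalSeq g (insertSeq r j (evalSeq h) b)) a) := fun j hj => by
    rw [insertSeq_insertSeq_mid _ _ _ _ (by have := Finset.mem_range.1 hj; omega)]
    congr 2; ring
  have e3 : ∀ j ∈ Finset.range (p - i), ((-1 : K) ^ ((i + 1 + j + q) * r + i * q)) •
        evalSeq f (insertSeq q i (evalSeq g) (insertSeq r (i + 1 + j + q) (evalSeq h) a))
      = ((-1 : K) ^ (q * r)) • ((-1 : K) ^ ((i + 1 + j) * r + i * q)) •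
        evalSeq f (insertSeq r (i + 1 + j) (evalSeq h) (insertSeq q i (evalSeq g) a)) :=
    fun j _ => by
      rw [← insertSeq_insertSeq_lt _ _ _ _ (by omega), smul_smul, ← pow_add]
      congr 2; ring
  rw [Finset.sum_congr rfl e1, Finset.sum_congr rfl e2, Finset.sum_congr rfl e3]
  abel

end preLie

/-! ### The grading of the direct sum. -/

namespace GradedHom

variable {K V W : Type*} [Field K] [AddCommGroup V] [Module K V] [AddCommGroup W] [Module K W]

theorem of_congr {m n : ℕ} (h : m = n) {f : MultilinearMap K (fun _ : Fin (m + 1) => V) W}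
    {g : MultilinearMap K (fun _ : Fin (n + 1) => V) W} (hfg : ∀ a, evalSeq f a = evalSeq g a) :
    of K V W m f = of K V W n g := by
  subst h
  rw [ext_evalSeq hfg]

theorem of_injective (n : ℕ) : Function.Injective (of K V W n) :=
  DirectSum.of_injective (β := fun n : ℕ => MultilinearMap K (fun _ : Fin (n + 1) => V) W) n

variable (K V W) in
theorem iSup_range_of : ⨆ n, LinearMap.range (of K V W n) = ⊤ := by
  refine eq_top_iff.2 fun x _ => ?_
  refine DirectSum.induction_on (motive := fun x : GradedHom K V W =>
    x ∈ ⨆ n, LinearMap.range (of K V W n)) x (zero_mem _) (fun n f => ?_)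
    (fun _ _ h h' => add_mem h h')
  exact Submodule.mem_iSup_of_mem n ⟨f, rfl⟩

variable (K V W) in
/-- The homogeneous elements of degree `d`. -/
def grading (d : ℤ) : Submodule K (GradedHom K V W) :=
  ⨆ (n : ℕ) (_ : (n : ℤ) = d), LinearMap.range (of K V W n)

theorem of_mem_grading (n : ℕ) (f : MultilinearMap K (fun _ : Fin (n + 1) => V) W) {d : ℤ}
    (h : (n : ℤ) = d) : of K V W n f ∈ grading K V W d :=
  Submodule.mem_iSup_of_mem n (Submodule.mem_iSup_of_mem h ⟨f, rfl⟩)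

theorem eq_zero_or_of_mem_grading {d : ℤ} {x : GradedHom K V W} (h : x ∈ grading K V W d) :
    x = 0 ∨ ∃ n : ℕ, (n : ℤ) = d ∧ ∃ f, x = of K V W n f := by
  by_cases hd : ∃ n : ℕ, (n : ℤ) = d
  · obtain ⟨n, rfl⟩ := hd
    have : grading K V W n = LinearMap.range (of K V W n) := by
      refine le_antisymm (iSup_le fun m => iSup_le fun hm => ?_)
        (fun _ ⟨f, hf⟩ => hf ▸ of_mem_grading n f rfl)
      rw [Nat.cast_inj.1 hm]
    rw [this] at h
    obtain ⟨f, rfl⟩ := h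
    exact Or.inr ⟨n, rfl, f, rfl⟩
  · left
    have : grading K V W d = ⊥ :=
      le_bot_iff.1 (iSup_le fun n => iSup_le fun hn => (hd ⟨n, hn⟩).elim)
    rwa [this] at h

theorem linearMap_ext {X : Type*} [AddCommGroup X] [Module K X] {φ ψ : GradedHom K V W →ₗ[K] X}
    (h : ∀ n f, φ (of K V W n f) = ψ (of K V W n f)) : φ = ψ := by
  refine LinearMap.ext fun x => ?_
  have hx : x ∈ ⨆ n, LinearMap.range (of K V W n) := by rw [iSup_range_of]; trivial
  have : (⨆ n, LinearMap.range (of K V W n)) ≤ LinearMap.eqLocus φ ψ :=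
    iSup_le fun n => by rintro _ ⟨f, rfl⟩; exact h n f
  exact this hx

variable (K V W) in
theorem isInternal_grading : DirectSum.IsInternal (grading K V W) := by
  refine (DirectSum.isInternal_submodule_iff_iSupIndep_and_iSup_eq_top _).2 ⟨fun d => ?_, ?_⟩
  -- Independence: the projection `π` onto the summand of degree `d` fixes that summand and kills
  -- all others.
  · let π : GradedHom K V W →ₗ[K] GradedHom K V W :=
      lift fun n => if (n : ℤ) = d then of K V W n else 0
    rw [Submodule.disjoint_def]
    intro x hx hx'
    have h0 : ⨆ e, ⨆ (_ : e ≠ d), grading K V W e ≤ LinearMap.ker π := by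
      refine iSup_le fun e => iSup_le fun he y hy => ?_
      rcases eq_zero_or_of_mem_grading hy with rfl | ⟨n, rfl, f, rfl⟩
      · exact zero_mem _
      · simp [π, lift_of, he]
    have h1 : π x = x := by
      rcases eq_zero_or_of_mem_grading hx with rfl | ⟨n, rfl, f, rfl⟩
      · exact map_zero _
      · simp [π, lift_of]
    rw [← h1]
    exact h0 hx'
  · refine eq_top_iff.2 ?_
    rw [← iSup_range_of]
    exact iSup_le fun n => le_trans (fun _ ⟨f, hf⟩ => hf ▸ of_mem_grading n f rfl)
      (le_iSup _ (n : ℤ))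

end GradedHom

/-! ### The graded Jacobi identity. -/

section jacobi

variable {K V : Type*} [Field K] [AddCommGroup V] [Module K V]

open GradedHom

theorem bracket_of (p q : ℕ) (f : MultilinearMap K (fun _ : Fin (p + 1) => V) V)
    (g : MultilinearMap K (fun _ : Fin (q + 1) => V) V) :
    bracket K V (of K V V p f) (of K V V q g)
      = of K V V (p + q) (diamond K V p q f g)
        - ((-1 : K) ^ (p * q)) • of K V V (q + p) (diamond K V q p g f) := by
  simp only [bracket, lift_of, LinearMap.flip_apply]
  rfl

variable (K V) in
/-- The operation `⋄`, extended bilinearly. -/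
def preLie : GradedHom K V V →ₗ[K] GradedHom K V V →ₗ[K] GradedHom K V V :=
  lift fun p => (lift fun q => ((diamond K V p q).compr₂ (of K V V (p + q))).flip).flip

theorem preLie_of (p q : ℕ) (f : MultilinearMap K (fun _ : Fin (p + 1) => V) V)
    (g : MultilinearMap K (fun _ : Fin (q + 1) => V) V) :
    preLie K V (of K V V p f) (of K V V q g) = of K V V (p + q) (diamond K V p q f g) := by
  simp only [preLie, lift_of, LinearMap.flip_apply]
  rfl

theorem preLie_associator (p q r : ℕ)
    (f : MultilinearMap K (fun _ : Fin (p + 1) => V) V)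
    (g : MultilinearMap K (fun _ : Fin (q + 1) => V) V)
    (h : MultilinearMap K (fun _ : Fin (r + 1) => V) V) :
    preLie K V (preLie K V (of K V V p f) (of K V V q g)) (of K V V r h)
        - preLie K V (of K V V p f) (preLie K V (of K V V q g) (of K V V r h))
      = ((-1 : K) ^ (q * r)) •
        (preLie K V (preLie K V (of K V V p f) (of K V V r h)) (of K V V q g)
          - preLie K V (of K V V p f) (preLie K V (of K V V r h) (of K V V q g))) := by
  simp only [preLie_of]
  -- Casting all terms to degree `p + q + r` puts them into one summand, where they can be compared
  -- on sequences.
  let cst {m n : ℕ} (e : m = n) (F : MultilinearMap K (fun _ : Fin (m + 1) => V) V) :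
    MultilinearMap K (fun _ : Fin (n + 1) => V) V := e ▸ F
  have hc : ∀ {m n : ℕ} (e : m = n) (F : MultilinearMap K (fun _ : Fin (m + 1) => V) V) (a),
      evalSeq (cst e F) a = evalSeq F a := fun e F a => by subst e; rfl
  have hof : ∀ {m n : ℕ} (e : m = n) (F : MultilinearMap K (fun _ : Fin (m + 1) => V) V),
      of K V V m F = of K V V n (cst e F) := fun e F => of_congr e fun a => (hc e F a).symm
  rw [hof (show p + (q + r) = p + q + r by ring), hof (show p + r + q = p + q + r by ring),
    hof (show p + (r + q) = p + q + r by ring), ← map_sub, ← map_sub, ← map_smul]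
  refine of_congr rfl fun a => ?_
  have hsub : ∀ {m : ℕ} (F G : MultilinearMap K (fun _ : Fin (m + 1) => V) V),
    evalSeq (F - G) a = evalSeq F a - evalSeq G a := fun F G => rfl
  rw [evalSeq_smul, hsub, hsub, hc, hc, hc, evalSeq_associator, evalSeq_associator p r q,
    mul_comm r q]
  have hs : ((-1 : K) ^ (q * r)) * (-1) ^ (q * r) = 1 := by
    rw [← pow_add]; exact (Even.add_self _).neg_one_pow
  simp only [add_sub_cancel_left, smul_add, smul_smul, hs, one_smul]
  abel

theorem bracket_eq_preLie (p q : ℕ) (f : MultilinearMap K (fun _ : Fin (p + 1) => V) V)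
    (g : MultilinearMap K (fun _ : Fin (q + 1) => V) V) :
    bracket K V (of K V V p f) (of K V V q g)
      = preLie K V (of K V V p f) (of K V V q g)
        - ((-1 : K) ^ (p * q)) • preLie K V (of K V V q g) (of K V V p f) := by
  rw [bracket_of, preLie_of, preLie_of]

theorem bracket_preLie_left (p q r : ℕ) (f : MultilinearMap K (fun _ : Fin (p + 1) => V) V)
    (g : MultilinearMap K (fun _ : Fin (q + 1) => V) V)
    (h : MultilinearMap K (fun _ : Fin (r + 1) => V) V) :
    bracket K V (preLie K V (of K V V p f) (of K V V q g)) (of K V V r h)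
      = preLie K V (preLie K V (of K V V p f) (of K V V q g)) (of K V V r h)
        - ((-1 : K) ^ ((p + q) * r)) •
          preLie K V (of K V V r h) (preLie K V (of K V V p f) (of K V V q g)) := by
  rw [preLie_of, bracket_eq_preLie]

theorem bracket_preLie_right (p q r : ℕ) (f : MultilinearMap K (fun _ : Fin (p + 1) => V) V)
    (g : MultilinearMap K (fun _ : Fin (q + 1) => V) V)
    (h : MultilinearMap K (fun _ : Fin (r + 1) => V) V) :
    bracket K V (of K V V r h) (preLie K V (of K V V p f) (of K V V q g))
      = preLie K V (of K V V r h) (preLie K V (of K V V p f) (of K V V q g))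
        - ((-1 : K) ^ (r * (p + q))) •
          preLie K V (preLie K V (of K V V p f) (of K V V q g)) (of K V V r h) := by
  rw [preLie_of, bracket_eq_preLie]

/-- The commutator of a graded pre-Lie product satisfies the graded Jacobi identity: the twelve
products cancel by the pre-Lie identity with `f`, `g` and `h` in turn as outermost factor. -/
theorem bracket_leibniz_of (p q r : ℕ)
    (f : MultilinearMap K (fun _ : Fin (p + 1) => V) V)
    (g : MultilinearMap K (fun _ : Fin (q + 1) => V) V)
    (h : MultilinearMap K (fun _ : Fin (r + 1) => V) V) :
    bracket K V (bracket K V (of K V V p f) (of K V V q g)) (of K V V r h)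
      = bracket K V (of K V V p f) (bracket K V (of K V V q g) (of K V V r h))
        + ((-1 : K) ^ (q * r)) •
          bracket K V (bracket K V (of K V V p f) (of K V V r h)) (of K V V q g) := by
  rw [bracket_eq_preLie p q, bracket_eq_preLie q r, bracket_eq_preLie p r]
  simp only [map_sub, map_smul, LinearMap.sub_apply, LinearMap.smul_apply, bracket_preLie_left,
    bracket_preLie_right]
  have a1 := preLie_associator p q r f g h
  have a2 := preLie_associator q p r g f h
  have a3 := preLie_associator r p q h f g
  simp only [add_mul, mul_add, pow_add] at a1 a2 a3 ⊢
  have c3 := mul_comm r q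
  -- Only the signs of `p * q`, `p * r`, `q * r` enter; once they are fixed, a signed sum of the
  -- three identities is the claim.
  rcases neg_one_pow_eq_or K (p * q) with e1 | e1 <;>
  rcases neg_one_pow_eq_or K (p * r) with e2 | e2 <;>
  rcases neg_one_pow_eq_or K (q * r) with e3 | e3 <;>
  simp only [c3, e1, e2, e3] at a1 a2 a3 ⊢
  · linear_combination (norm := module) a1 - a2 + a3
  · linear_combination (norm := module) a1 - a2 - a3
  · linear_combination (norm := module) a1 - a2 - a3
  · linear_combination (norm := module) a1 - a2 + a3
  · linear_combination (norm := module) a1 + a2 + a3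
  · linear_combination (norm := module) a1 + a2 - a3
  · linear_combination (norm := module) a1 + a2 - a3
  · linear_combination (norm := module) a1 + a2 + a3

end jacobi

end Gerst

/-! ### Selections of indices and their Koszul signs. -/

theorem parity_sum {ι : Type*} (s : Finset ι) (f : ι → ℤ) :
    parity (∑ i ∈ s, f i) = ∏ i ∈ s, parity (f i) := by
  classical
  induction s using Finset.induction_on with
  | empty => simp [parity_zero]
  | insert a s ha ih => rw [Finset.sum_insert ha, Finset.prod_insert ha, parity_add, ih]

theorem parity_neg_smul {M : Type*} [AddCommGroup M] (n : ℤ) (x : M) :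
    -(parity n • x) = parity (n + 1) • x := by
  simp [parity, Int.negOnePow_succ]

section selections

/-- The indices selected by `c`, in increasing order. -/
def picked {N : ℕ} (c : Fin N → Bool) : List (Fin N) := (List.finRange N).filter c

theorem mem_picked {N : ℕ} {c : Fin N → Bool} {j : Fin N} : j ∈ picked c ↔ c j = true := by
  simp [picked]

theorem picked_cons_true {N : ℕ} (c : Fin N → Bool) :
    picked (Fin.cons true c : Fin (N + 1) → Bool) = 0 :: (picked c).map Fin.succ := by
  simp [picked, List.finRange_succ, List.filter_map, Function.comp_def]

theorem picked_cons_false {N : ℕ} (c : Fin N → Bool) :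
    picked (Fin.cons false c : Fin (N + 1) → Bool) = (picked c).map Fin.succ := by
  simp [picked, List.finRange_succ, List.filter_map, Function.comp_def]

/-- The complementary selection. -/
def complSel {N : ℕ} (c : Fin N → Bool) : Fin N → Bool := fun j => !c j

theorem complSel_cons {N : ℕ} (b : Bool) (c : Fin N → Bool) :
    complSel (Fin.cons b c : Fin (N + 1) → Bool) = Fin.cons (!b) (complSel c) := by
  funext j
  refine Fin.cases ?_ (fun j => ?_) j <;> simp [complSel]

theorem complSel_complSel {N : ℕ} (c : Fin N → Bool) : complSel (complSel c) = c := by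
  funext j; simp [complSel]

/-- The total degree of the selected indices. -/
def degSel {N : ℕ} (d : Fin N → ℤ) (c : Fin N → Bool) : ℤ := ∑ s, if c s then d s else 0

theorem sum_map_picked {N : ℕ} (d : Fin N → ℤ) (c : Fin N → Bool) :
    ((picked c).map d).sum = degSel d c := by
  induction N with
  | zero => simp [picked, degSel]
  | succ N ih =>
    rw [← Fin.cons_self_tail c]
    rcases c 0
    · rw [picked_cons_false, List.map_map, degSel, Fin.sum_univ_succ]
      simpa [degSel] using ih (d ∘ Fin.succ) (Fin.tail c)
    · rw [picked_cons_true, List.map_cons, List.map_map, List.sum_cons, degSel, Fin.sum_univ_succ]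
      simpa [degSel] using ih (d ∘ Fin.succ) (Fin.tail c)

/-- The exponent of the Koszul sign for moving the selected elements to the front. -/
def moveExp {N : ℕ} (d : Fin N → ℤ) (c : Fin N → Bool) : ℤ :=
  ∑ s, ∑ t, if c s = true ∧ c t = false ∧ t < s then d s * d t else 0

theorem degSel_cons {N : ℕ} (d : Fin (N + 1) → ℤ) (b : Bool) (c : Fin N → Bool) :
    degSel d (Fin.cons b c) = (if b then d 0 else 0) + degSel (d ∘ Fin.succ) c := by
  simp [degSel, Fin.sum_univ_succ]

theorem moveExp_cons_true {N : ℕ} (d : Fin (N + 1) → ℤ) (c : Fin N → Bool) :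
    moveExp d (Fin.cons true c) = moveExp (d ∘ Fin.succ) c := by
  simp [moveExp, Fin.sum_univ_succ]

/-- Every selected element has to pass the unselected element at index `0`. -/
theorem moveExp_cons_false {N : ℕ} (d : Fin (N + 1) → ℤ) (c : Fin N → Bool) :
    moveExp d (Fin.cons false c)
      = d 0 * degSel (d ∘ Fin.succ) c + moveExp (d ∘ Fin.succ) c := by
  simp [moveExp, degSel, Fin.sum_univ_succ, Finset.sum_add_distrib, Finset.mul_sum, mul_comm]

/-- A pair of one selected and one unselected index is counted in exactly one of the two exponents,
according to its order. -/
theorem moveExp_add_compl {N : ℕ} (d : Fin N → ℤ) (c : Fin N → Bool) :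
    moveExp d c + moveExp d (complSel c) = degSel d c * degSel d (complSel c) := by
  induction N with
  | zero => simp [moveExp, degSel]
  | succ N ih =>
    rw [← Fin.cons_self_tail c, complSel_cons]
    have := ih (d ∘ Fin.succ) (Fin.tail c)
    rcases c 0
    · simp only [Bool.not_false, moveExp_cons_true, moveExp_cons_false, degSel_cons]
      simp
      linear_combination this
    · simp only [Bool.not_true, moveExp_cons_true, moveExp_cons_false, degSel_cons]
      simp
      linear_combination this

theorem sum_selections_succ {M : Type*} [AddCommMonoid M] {N : ℕ}
    (F : (Fin (N + 1) → Bool) → M) :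
    ∑ c, F c = (∑ c : Fin N → Bool, F (Fin.cons true c)) + ∑ c : Fin N → Bool, F (Fin.cons false c) := by
  rw [← (Fin.consEquiv fun _ : Fin (N + 1) => Bool).sum_comp, Fintype.sum_prod_type,
    Fintype.sum_bool]
  rfl

end selections

/-! ### Derived brackets and their quadratic identity. -/

section derivedBrackets

variable {K G M : Type*} [Field K] [AddCommGroup G] [Module K G] [AddCommGroup M] [Module K M]

/-- The iterated bracket `a ↦ [⋯[[a, x_1], x_2], …, x_k]` for a list `x_1, …, x_k`. -/
def nested (br : G →ₗ[K] G →ₗ[K] G) (incl : M →ₗ[K] G) : List M → G →ₗ[K] G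
  | [] => LinearMap.id
  | x :: L => nested br incl L ∘ₗ br.flip (incl x)

/-- Voronov's data for higher derived brackets: a graded Lie algebra `G` with an abelian
subalgebra `M` and a projection `proj` to `M` whose kernel is a subalgebra. -/
structure IsVoronovData (𝒢 : ℤ → Submodule K G) (ℬ : ℤ → Submodule K M)
    (br : G →ₗ[K] G →ₗ[K] G) (incl : M →ₗ[K] G) (proj : G →ₗ[K] M) : Prop where
  bracket_mem : ∀ {p q a b}, a ∈ 𝒢 p → b ∈ 𝒢 q → br a b ∈ 𝒢 (p + q)
  skew : ∀ {p q a b}, a ∈ 𝒢 p → b ∈ 𝒢 q → br a b = -(parity (p * q) • br b a)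
  leibniz : ∀ {p q s a b c}, a ∈ 𝒢 p → b ∈ 𝒢 q → c ∈ 𝒢 s →
    br (br a b) c = br a (br b c) + parity (q * s) • br (br a c) b
  incl_mem : ∀ {d x}, x ∈ ℬ d → incl x ∈ 𝒢 d
  proj_mem : ∀ {d a}, a ∈ 𝒢 d → proj a ∈ ℬ d
  proj_incl : ∀ x, proj (incl x) = x
  abelian : ∀ x y, br (incl x) (incl y) = 0
  ker_subalgebra : ∀ {a b}, proj a = 0 → proj b = 0 → proj (br a b) = 0

namespace IsVoronovData

variable {𝒢 : ℤ → Submodule K G} {ℬ : ℤ → Submodule K M} {br : G →ₗ[K] G →ₗ[K] G}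
  {incl : M →ₗ[K] G} {proj : G →ₗ[K] M}

theorem nested_cons (x : M) (L : List M) (a : G) :
    nested br incl (x :: L) a = nested br incl L (br a (incl x)) := rfl

theorem nested_concat (L : List M) (y : M) (a : G) :
    nested br incl (L ++ [y]) a = br (nested br incl L a) (incl y) := by
  induction L generalizing a with
  | nil => rfl
  | cons x L ih => exact ih _

theorem nested_mem (h : IsVoronovData 𝒢 ℬ br incl proj) {ι : Type*} (d : ι → ℤ) (x : ι → M)
    (hx : ∀ j, x j ∈ ℬ (d j)) (L : List ι) {p : ℤ} {a : G} (ha : a ∈ 𝒢 p) :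
    nested br incl (L.map x) a ∈ 𝒢 (p + (L.map d).sum) := by
  induction L generalizing p a with
  | nil => simpa [nested] using ha
  | cons j L ih =>
    have := ih (h.bracket_mem ha (h.incl_mem (hx j)))
    rwa [List.map_cons, List.map_cons, List.sum_cons, nested_cons, ← add_assoc]

theorem bracket_bracket_incl (h : IsVoronovData 𝒢 ℬ br incl proj) {p q s : ℤ} {a : G} {x y : M}
    (ha : a ∈ 𝒢 p) (hx : x ∈ ℬ q) (hy : y ∈ ℬ s) :
    br (br a (incl x)) (incl y) = parity (q * s) • br (br a (incl y)) (incl x) := by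
  rw [h.leibniz ha (h.incl_mem hx) (h.incl_mem hy), h.abelian, map_zero, zero_add]

/-- As `M` is abelian, bracketings with its elements graded-commute, so the last entry moves to the
front past all others. -/
theorem nested_concat_eq_cons (h : IsVoronovData 𝒢 ℬ br incl proj) {ι : Type*} (d : ι → ℤ)
    (x : ι → M) (hx : ∀ j, x j ∈ ℬ (d j)) (L : List ι) {p e : ℤ} {a : G} {y : M} (ha : a ∈ 𝒢 p)
    (hy : y ∈ ℬ e) :
    nested br incl (L.map x ++ [y]) a
      = parity (e * (L.map d).sum) • nested br incl (y :: L.map x) a := by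
  induction L generalizing p a with
  | nil => simp [parity_zero]
  | cons j L ih =>
    rw [List.map_cons, List.cons_append, nested_cons, ih (h.bracket_mem ha (h.incl_mem (hx j))),
      nested_cons, h.bracket_bracket_incl ha (hx j) hy, map_zsmul, nested_cons, nested_cons,
      smul_smul, ← parity_add, List.map_cons, List.sum_cons]
    congr 2; ring

/-- Each bracketing with `x j` is a graded derivation, so each `x j` goes either to `a` (selected)
or to `b`. On its way to `a` it passes `b`, which gives `q * degSel d c`, and the earlier entries
already given to `b`, which gives `moveExp d c`. -/
theorem nested_bracket (h : IsVoronovData 𝒢 ℬ br incl proj) {N : ℕ} (d : Fin N → ℤ)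
    (x : Fin N → M) (hx : ∀ j, x j ∈ ℬ (d j)) {p q : ℤ} {a b : G} (ha : a ∈ 𝒢 p) (hb : b ∈ 𝒢 q) :
    nested br incl (List.ofFn x) (br a b)
      = ∑ c : Fin N → Bool, parity (q * degSel d c + moveExp d c) •
          br (nested br incl ((picked c).map x) a)
            (nested br incl ((picked (complSel c)).map x) b) := by
  induction N generalizing p q a b with
  | zero => simp [picked, nested, degSel, moveExp, parity_zero]
  | succ N ih =>
    have hx' : ∀ j, (x ∘ Fin.succ) j ∈ ℬ ((d ∘ Fin.succ) j) := fun j => hx _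
    -- In `e1` the entry `x 0` goes to `b`, in `e2` to `a`.
    have e1 := ih (d ∘ Fin.succ) (x ∘ Fin.succ) hx' ha (h.bracket_mem hb (h.incl_mem (hx 0)))
    have e2 := ih (d ∘ Fin.succ) (x ∘ Fin.succ) hx' (h.bracket_mem ha (h.incl_mem (hx 0))) hb
    rw [List.ofFn_succ, nested_cons, h.leibniz ha hb (h.incl_mem (hx 0)), map_add, map_zsmul]
    change nested br incl (List.ofFn (x ∘ Fin.succ)) _
      + _ • nested br incl (List.ofFn (x ∘ Fin.succ)) _ = _
    rw [e1, e2, sum_selections_succ, add_comm, Finset.smul_sum]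
    congr 1
    · refine Finset.sum_congr rfl fun c _ => ?_
      rw [complSel_cons, Bool.not_true, picked_cons_true, picked_cons_false, List.map_cons,
        nested_cons, List.map_map, List.map_map, moveExp_cons_true, degSel_cons, parity_smul_smul]
      congr 2
      simp only [if_true]; ring
    · refine Finset.sum_congr rfl fun c _ => ?_
      rw [complSel_cons, Bool.not_false, picked_cons_true, picked_cons_false, List.map_cons,
        nested_cons, List.map_map, List.map_map, moveExp_cons_false, degSel_cons]
      congr 2
      simp only [Bool.false_eq_true, if_false]; ring

/-- Expand the bracket of `a - incl (proj a)` and `b - incl (proj b)`, which lie in the kernel of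
`proj`; the term with two projections vanishes as `M` is abelian. -/
theorem proj_bracket (h : IsVoronovData 𝒢 ℬ br incl proj) (a b : G) :
    proj (br a b) = proj (br (incl (proj a)) b) + proj (br a (incl (proj b))) := by
  have := h.ker_subalgebra (a := a - incl (proj a)) (b := b - incl (proj b))
    (by rw [map_sub, h.proj_incl, sub_self]) (by rw [map_sub, h.proj_incl, sub_self])
  simp only [map_sub, LinearMap.sub_apply, h.abelian, sub_zero] at this
  rwa [sub_eq_zero, sub_eq_iff_eq_add'] at this

/-- The Jacobi identity for the higher derived brackets, as a sum over selections. -/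
theorem sum_selections_eq_zero (h : IsVoronovData 𝒢 ℬ br incl proj) [CharZero K] {Δ : G}
    (hΔ : Δ ∈ 𝒢 1) (hΔΔ : br Δ Δ = 0) {N : ℕ} (d : Fin N → ℤ)
    (x : Fin N → M) (hx : ∀ j, x j ∈ ℬ (d j)) :
    ∑ c : Fin N → Bool, parity (moveExp d c) •
      proj (nested br incl (proj (nested br incl ((picked c).map x) Δ) ::
        (picked (complSel c)).map x) Δ) = 0 := by
  set X : (Fin N → Bool) → M := fun c => proj (nested br incl
    (proj (nested br incl ((picked c).map x) Δ) :: (picked (complSel c)).map x) Δ) with hX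
  -- By `proj_bracket` each term in the expansion of `[Δ, Δ]` splits into the Jacobi terms of `c`
  -- and of its complement.
  have key : ∀ c : Fin N → Bool, parity (1 * degSel d c + moveExp d c) •
      proj (br (nested br incl ((picked c).map x) Δ)
        (nested br incl ((picked (complSel c)).map x) Δ))
      = parity (moveExp d c) • X c + parity (moveExp d (complSel c)) • X (complSel c) := fun c => by
    have hD : ∀ c, nested br incl ((picked c).map x) Δ ∈ 𝒢 (1 + degSel d c) := fun c => by
      rw [← sum_map_picked]; exact h.nested_mem d x hx _ hΔ
    have hP : ∀ c, proj (nested br incl ((picked c).map x) Δ) ∈ ℬ (1 + degSel d c) :=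
      fun c => h.proj_mem (hD c)
    have hr : ∀ c, br (nested br incl ((picked c).map x) Δ)
          (incl (proj (nested br incl ((picked (complSel c)).map x) Δ)))
        = parity ((1 + degSel d (complSel c)) * degSel d c) •
          nested br incl (proj (nested br incl ((picked (complSel c)).map x) Δ) ::
            (picked c).map x) Δ := fun c => by
      rw [← nested_concat, h.nested_concat_eq_cons d x hx _ hΔ (hP _), sum_map_picked]
    have hr' := hr (complSel c)
    have hr := hr c
    rw [complSel_complSel] at hr'
    have hc := moveExp_add_compl d c
    rw [h.proj_bracket, h.skew (h.incl_mem (hP c)) (hD (complSel c)), hr', hr, parity_smul_smul,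
      parity_neg_smul, map_zsmul, map_zsmul, smul_add, parity_smul_smul, parity_smul_smul]
    simp only [hX, complSel_complSel]
    congr 2
    · refine parity_eq_of_even_sub
        ⟨degSel d c + 1 + degSel d (complSel c) * (1 + degSel d c), by ring⟩
    · refine parity_eq_of_even_sub ⟨degSel d c + moveExp d c, by linear_combination -hc⟩
  have h0 : proj (nested br incl (List.ofFn x) (br Δ Δ)) = 0 := by rw [hΔΔ, map_zero, map_zero]
  rw [h.nested_bracket d x hx hΔ hΔ, map_sum] at h0
  simp only [map_zsmul, key] at h0
  rw [Finset.sum_add_distrib] at h0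
  -- Complementation is an involution, so the expansion is twice the Jacobi sum.
  have hswap : ∑ c : Fin N → Bool, parity (moveExp d (complSel c)) • X (complSel c)
      = ∑ c : Fin N → Bool, parity (moveExp d c) • X c :=
    Finset.sum_bij' (fun c _ => complSel c) (fun c _ => complSel c)
      (fun _ _ => Finset.mem_univ _) (fun _ _ => Finset.mem_univ _)
      (fun c _ => complSel_complSel c) (fun c _ => complSel_complSel c) (fun _ _ => rfl)
  rw [hswap, ← two_smul K] at h0
  exact (smul_eq_zero.1 h0).resolve_left two_ne_zero

end IsVoronovData

end derivedBrackets

/-! ### Koszul signs of permutations and the symmetry of derived brackets. -/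

namespace LInfty

theorem koszulSign_eq_prod {k : ℕ} (d : Fin k → ℤ) (σ : Equiv.Perm (Fin k)) :
    koszulSign d σ = ∏ p : Fin k × Fin k,
      if p.1 < p.2 ∧ σ p.2 < σ p.1 then parity (d (σ p.1) * d (σ p.2)) else 1 := by
  rw [koszulSign, Finset.prod_filter]
  rfl

theorem koszulSign_one {k : ℕ} (d : Fin k → ℤ) : koszulSign d 1 = 1 := by
  rw [koszulSign_eq_prod]
  refine Finset.prod_eq_one fun p _ => if_neg fun h => ?_
  exact lt_asymm h.1 h.2

theorem swap_castSucc_succ_lt_iff {n : ℕ} (i : Fin n) (p q : Fin (n + 1))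
    (h1 : ¬ (p = i.castSucc ∧ q = i.succ)) (h2 : ¬ (p = i.succ ∧ q = i.castSucc)) :
    Equiv.swap i.castSucc i.succ p < Equiv.swap i.castSucc i.succ q ↔ p < q := by
  simp only [Equiv.swap_apply_def, Fin.ext_iff, Fin.val_castSucc, Fin.val_succ] at h1 h2 ⊢
  split_ifs <;> simp only [Fin.lt_def, Fin.val_castSucc, Fin.val_succ] <;> omega

/-- An adjacent transposition preserves the order of every pair of positions but the one it
exchanges, so only the factor of that pair appears or disappears; as it squares to `1`, both cases
multiply the sign by it. -/
theorem koszulSign_mul_swap {n : ℕ} (d : Fin (n + 1) → ℤ) (σ : Equiv.Perm (Fin (n + 1)))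
    (i : Fin n) :
    koszulSign d (σ * Equiv.swap i.castSucc i.succ)
      = koszulSign d σ * parity (d (σ i.castSucc) * d (σ i.succ)) := by
  set u := i.castSucc
  set v := i.succ
  set τ := Equiv.swap u v
  have huv : u < v := Fin.castSucc_lt_succ
  set s := parity (d (σ u) * d (σ v)) with hs
  have hs' : parity (d (σ v) * d (σ u)) = s := by rw [mul_comm]
  have hss : s * s = 1 := parity_mul_self _
  have h1 : koszulSign d (σ * τ) = ∏ p : Fin (n + 1) × Fin (n + 1),
      if τ p.1 < τ p.2 ∧ σ p.2 < σ p.1 then parity (d (σ p.1) * d (σ p.2)) else 1 := by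
    rw [koszulSign_eq_prod, ← (Equiv.prodCongr τ τ).prod_comp]
    refine Finset.prod_congr rfl fun p _ => ?_
    simp [τ]
  have h2 : ∀ p : Fin (n + 1) × Fin (n + 1),
      (if τ p.1 < τ p.2 ∧ σ p.2 < σ p.1 then parity (d (σ p.1) * d (σ p.2)) else 1)
        = (if p.1 < p.2 ∧ σ p.2 < σ p.1 then parity (d (σ p.1) * d (σ p.2)) else 1)
          * ((if p = (u, v) then (if σ v < σ u then s else 1) else 1)
            * (if p = (v, u) then (if σ u < σ v then s else 1) else 1)) := by
    rintro ⟨p, q⟩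
    by_cases e1 : p = u ∧ q = v
    · obtain ⟨rfl, rfl⟩ := e1
      have : (u, v) ≠ (v, u) := fun h => huv.ne (Prod.ext_iff.1 h).1
      simp only [τ, Equiv.swap_apply_left, Equiv.swap_apply_right, huv, huv.asymm, this, if_true,
        if_false, true_and, false_and, mul_one]
      split_ifs
      · exact hss.symm
      · simp
    by_cases e2 : p = v ∧ q = u
    · obtain ⟨rfl, rfl⟩ := e2
      have : (v, u) ≠ (u, v) := fun h => huv.ne (Prod.ext_iff.1 h).2
      simp only [τ, Equiv.swap_apply_left, Equiv.swap_apply_right, huv, huv.asymm, this, if_true,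
        if_false, true_and, false_and, one_mul, hs']
    · simp only [Prod.mk.injEq, e1, e2, if_false, mul_one,
        swap_castSucc_succ_lt_iff i p q e1 e2, τ, u, v]
  rw [h1, Finset.prod_congr rfl fun p _ => h2 p, Finset.prod_mul_distrib, Finset.prod_mul_distrib,
    ← koszulSign_eq_prod, Finset.prod_ite_eq' Finset.univ (u, v), Finset.prod_ite_eq' Finset.univ (v, u)]
  simp only [Finset.mem_univ, if_true]
  rcases lt_or_gt_of_ne (σ.injective.ne huv.ne) with h | h
  · simp [h, h.asymm]
  · simp [h, h.asymm]

end LInfty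

section symmetry

variable {K G M : Type*} [Field K] [AddCommGroup G] [Module K G] [AddCommGroup M] [Module K M]
variable {𝒢 : ℤ → Submodule K G} {ℬ : ℤ → Submodule K M} {br : G →ₗ[K] G →ₗ[K] G}
  {incl : M →ₗ[K] G} {proj : G →ₗ[K] M}

open LInfty

namespace IsVoronovData

theorem nested_swap (h : IsVoronovData 𝒢 ℬ br incl proj) {n : ℕ} (i : Fin n)
    (d : Fin (n + 1) → ℤ) (x : Fin (n + 1) → M) (hx : ∀ j, x j ∈ ℬ (d j)) {p : ℤ} {a : G}
    (ha : a ∈ 𝒢 p) :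
    nested br incl (List.ofFn fun j => x (Equiv.swap i.castSucc i.succ j)) a
      = parity (d i.castSucc * d i.succ) • nested br incl (List.ofFn x) a := by
  induction n generalizing p a with
  | zero => exact i.elim0
  | succ n ih =>
    induction i using Fin.cases with
    | zero =>
      rw [List.ofFn_succ, List.ofFn_succ, List.ofFn_succ (f := x), List.ofFn_succ]
      have e : ∀ j : Fin n, Equiv.swap (Fin.castSucc (0 : Fin (n + 1))) (Fin.succ 0) j.succ.succ
          = j.succ.succ := fun j =>
        Equiv.swap_apply_of_ne_of_ne (by simp [Fin.ext_iff]) (by simp [Fin.ext_iff])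
      have e0 : Equiv.swap (Fin.castSucc (0 : Fin (n + 1))) (Fin.succ 0) 0 = Fin.succ 0 :=
        Equiv.swap_apply_left _ _
      have e1 : Equiv.swap (Fin.castSucc (0 : Fin (n + 1))) (Fin.succ 0) (Fin.succ 0) = 0 :=
        Equiv.swap_apply_right _ _
      simp only [e, e0, e1, nested_cons]
      rw [h.bracket_bracket_incl ha (hx _) (hx _), map_zsmul, mul_comm]
      rfl
    | succ i =>
      have e : ∀ j : Fin (n + 1), Equiv.swap i.succ.castSucc i.succ.succ j.succ
          = (Equiv.swap i.castSucc i.succ j).succ := fun j => by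
        rw [← Fin.succ_castSucc]
        exact (Fin.succ_injective _).swap_apply _ _ _
      have e0 : Equiv.swap i.succ.castSucc i.succ.succ 0 = 0 :=
        Equiv.swap_apply_of_ne_of_ne (by simp [Fin.ext_iff]) (by simp [Fin.ext_iff])
      rw [List.ofFn_succ, List.ofFn_succ (f := x), nested_cons, nested_cons]
      simp only [e, e0]
      exact ih i (d ∘ Fin.succ) (x ∘ Fin.succ) (fun _ => hx _)
        (h.bracket_mem ha (h.incl_mem (hx 0)))

/-- Adjacent transpositions generate the symmetric group, already as a monoid, and both sides change
by the same sign under right multiplication by one. -/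
theorem nested_perm (h : IsVoronovData 𝒢 ℬ br incl proj) {k : ℕ} (d : Fin k → ℤ)
    (x : Fin k → M) (hx : ∀ j, x j ∈ ℬ (d j)) {p : ℤ} {a : G} (ha : a ∈ 𝒢 p)
    (σ : Equiv.Perm (Fin k)) :
    nested br incl (List.ofFn fun j => x (σ j)) a
      = koszulSign d σ • nested br incl (List.ofFn x) a := by
  cases k with
  | zero => rw [Subsingleton.elim σ 1, koszulSign_one, one_smul]; rfl
  | succ n =>
    have hσ : σ ∈ Submonoid.closure
        (Set.range fun i : Fin n => Equiv.swap i.castSucc i.succ) := by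
      rw [Equiv.Perm.mclosure_swap_castSucc_succ]; trivial
    induction hσ using Submonoid.closure_induction_right with
    | one => rw [koszulSign_one, one_smul]; rfl
    | mul_right σ _ τ hτ ih =>
      obtain ⟨i, rfl⟩ := hτ
      have := h.nested_swap i (fun j => d (σ j)) (fun j => x (σ j)) (fun j => hx _) ha
      simp only [Equiv.Perm.mul_apply]
      rw [this, ih, koszulSign_mul_swap, smul_smul, mul_comm]

end IsVoronovData

end symmetry

/-! ### Shuffles correspond to selections. -/

namespace LInfty

/-- The indices which `σ` places in the first `i` positions. -/
def firstSel {N : ℕ} (i : ℕ) (σ : Equiv.Perm (Fin N)) : Fin N → Bool :=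
  fun j => decide ((σ.symm j : ℕ) < i)

theorem firstSel_apply {N : ℕ} (i : ℕ) (σ : Equiv.Perm (Fin N)) (m : Fin N) :
    firstSel i σ (σ m) = decide ((m : ℕ) < i) := by
  simp [firstSel]

/-- A shuffle is the stable sort that brings the selected indices to the front, so its selection
determines it. The complement occurs because `false < true`. -/
theorem IsShuffle.eq_sort {N i : ℕ} {σ : Equiv.Perm (Fin N)} (h : IsShuffle i σ) :
    σ = Tuple.sort (complSel (firstSel i σ)) := by
  rw [Tuple.eq_sort_iff]
  constructor
  · intro a b hab
    have : (a : ℕ) ≤ b := hab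
    simp only [Function.comp, complSel, firstSel_apply]
    by_cases hb : (b : ℕ) < i
    · simp [hb, lt_of_le_of_lt this hb]
    · simp [hb, Bool.le_true]
  · intro a b hab he
    simp only [complSel, firstSel_apply, Bool.not_eq_eq_eq_not, Bool.not_not, decide_eq_decide]
      at he
    refine h a b hab ?_
    omega

theorem exists_threshold {N : ℕ} (u : Fin N → Bool) (hu : Monotone u) :
    ∃ i ≤ N, ∀ m : Fin N, u m = !decide ((m : ℕ) < i) := by
  by_cases h : ∃ i, ∃ hi : i < N, u ⟨i, hi⟩ = true
  · classical
    obtain ⟨hN, hi⟩ := Nat.find_spec h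
    refine ⟨Nat.find h, hN.le, fun m => ?_⟩
    by_cases hm : (m : ℕ) < Nat.find h
    · have := Nat.find_min h hm
      simp only [not_exists, Bool.not_eq_true] at this
      simp only [hm, decide_true, Bool.not_true]
      exact this m.2
    · simp only [hm, decide_false, Bool.not_false]
      have h1 := hu (show (⟨Nat.find h, hN⟩ : Fin N) ≤ m from not_lt.1 hm)
      rw [hi] at h1
      exact Bool.eq_true_of_true_le h1
  · refine ⟨N, le_rfl, fun m => ?_⟩
    simp only [not_exists, Bool.not_eq_true] at h
    simp [m.2, h m m.2]

theorem exists_shuffle_firstSel_eq {N : ℕ} (c : Fin N → Bool) :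
    ∃ i ≤ N, ∃ σ : Equiv.Perm (Fin N), IsShuffle i σ ∧ firstSel i σ = c := by
  obtain ⟨hmono, htie⟩ := Tuple.eq_sort_iff.1 (rfl : Tuple.sort (complSel c) = _)
  set σ := Tuple.sort (complSel c)
  obtain ⟨i, hi, hu⟩ := exists_threshold _ hmono
  simp only [Function.comp, complSel, Bool.not_eq_eq_eq_not, Bool.not_not] at hu
  refine ⟨i, hi, σ, fun a b hab h => htie a b hab ?_, ?_⟩
  · simp only [complSel, hu, Bool.not_eq_eq_eq_not, Bool.not_not, decide_eq_decide]
    have : (a : ℕ) < b := hab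
    omega
  · funext j
    obtain ⟨m, rfl⟩ := σ.surjective j
    rw [firstSel_apply, hu]

theorem IsShuffle.ofFn_first {N i : ℕ} (hi : i ≤ N) {σ : Equiv.Perm (Fin N)} (h : IsShuffle i σ) :
    (List.ofFn fun j : Fin i => σ ⟨j, by omega⟩) = picked (firstSel i σ) := by
  refine List.SortedLT.eq_of_mem_iff (List.sortedLT_ofFn_iff.2 fun a b hab => ?_)
    ((List.sortedLT_finRange N).pairwise.filter _).sortedLT fun j => ?_
  · exact h _ _ hab (Or.inl b.2)
  · rw [mem_picked, List.mem_ofFn]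
    obtain ⟨m, rfl⟩ := σ.surjective j
    rw [firstSel_apply, decide_eq_true_eq]
    constructor
    · rintro ⟨t, ht⟩
      rw [← σ.injective ht]
      exact t.2
    · exact fun hm => ⟨⟨m, hm⟩, rfl⟩

theorem IsShuffle.ofFn_last {N i : ℕ} (hi : i ≤ N) {σ : Equiv.Perm (Fin N)} (h : IsShuffle i σ) :
    (List.ofFn fun j : Fin (N - i) => σ ⟨i + j, by omega⟩) = picked (complSel (firstSel i σ)) := by
  refine List.SortedLT.eq_of_mem_iff (List.sortedLT_ofFn_iff.2 fun a b hab => ?_)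
    ((List.sortedLT_finRange N).pairwise.filter _).sortedLT fun j => ?_
  · exact h _ _ (show i + (a : ℕ) < i + b by have : (a : ℕ) < b := hab; omega)
      (Or.inr (Nat.le_add_right _ _))
  · rw [mem_picked, List.mem_ofFn]
    obtain ⟨m, rfl⟩ := σ.surjective j
    rw [complSel, firstSel_apply, Bool.not_eq_true', decide_eq_false_iff_not]
    constructor
    · rintro ⟨t, ht⟩
      rw [← σ.injective ht]
      simp
    · exact fun hm => ⟨⟨m - i, by omega⟩, congrArg σ (Fin.ext (by simp; omega))⟩

/-- A shuffle has no inversions within a block, so its inversions are the selected indices that pass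
a smaller unselected one. -/
theorem IsShuffle.koszulSign_eq {N i : ℕ} (d : Fin N → ℤ) {σ : Equiv.Perm (Fin N)}
    (h : IsShuffle i σ) : koszulSign d σ = parity (moveExp d (firstSel i σ)) := by
  rw [koszulSign_eq_prod, moveExp, ← Fintype.sum_prod_type', ← (Equiv.prodCongr σ σ).sum_comp,
    parity_sum]
  refine Finset.prod_congr rfl fun p _ => ?_
  simp only [Equiv.prodCongr_apply, Prod.map_fst, Prod.map_snd, firstSel_apply,
    decide_eq_true_eq, decide_eq_false_iff_not]
  have : (p.1 < p.2 ∧ σ p.2 < σ p.1) ↔ ((p.1 : ℕ) < i ∧ ¬ (p.2 : ℕ) < i ∧ σ p.2 < σ p.1) := by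
    constructor
    · rintro ⟨h1, h2⟩
      have h3 : ¬ ((p.2 : ℕ) < i ∨ i ≤ (p.1 : ℕ)) := fun h' => lt_asymm h2 (h _ _ h1 h')
      exact ⟨by omega, by omega, h2⟩
    · rintro ⟨h1, h2, h3⟩
      exact ⟨show (p.1 : ℕ) < p.2 by omega, h3⟩
  simp only [this]
  split_ifs
  · rfl
  · exact parity_zero.symm

end LInfty

/-! ### Voronov's theorem. -/

section voronov

variable {K G M : Type*} [Field K] [AddCommGroup G] [Module K G] [AddCommGroup M] [Module K M]
variable {𝒢 : ℤ → Submodule K G} {ℬ : ℤ → Submodule K M} {br : G →ₗ[K] G →ₗ[K] G}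
  {incl : M →ₗ[K] G} {proj : G →ₗ[K] M}

open LInfty

/-- Voronov's theorem: higher derived brackets form a (curved) `L_∞`-algebra. -/
theorem IsVoronovData.isCurvedLInfinity (h : IsVoronovData 𝒢 ℬ br incl proj) [CharZero K]
    (hℬ : DirectSum.IsInternal ℬ) {Δ : G} (hΔ : Δ ∈ 𝒢 1) (hΔΔ : br Δ Δ = 0)
    (l : (k : ℕ) → MultilinearMap K (fun _ : Fin k => M) M)
    (hl : ∀ k x, l k x = proj (nested br incl (List.ofFn x) Δ)) : IsCurvedLInfinity ℬ l where
  graded := hℬ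
  degree_one k d x hx := by
    rw [hl, add_comm, ← List.sum_ofFn, List.ofFn_eq_map, List.ofFn_eq_map]
    exact h.proj_mem (h.nested_mem d x hx _ hΔ)
  symmetric k d x hx σ := by
    rw [hl, hl, h.nested_perm d x hx hΔ, map_zsmul]
  jacobi N d x hx := by
    classical
    -- Pairs of `i` and an `(i, N - i)`-shuffle are in bijection with selections: the stable sort
    -- recovers the shuffle, the number of selected indices recovers `i`.
    rw [← h.sum_selections_eq_zero hΔ hΔΔ d x hx, Finset.sum_sigma']
    refine Finset.sum_bij (fun s _ => firstSel (s.1 : ℕ) s.2) (fun _ _ => Finset.mem_univ _)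
      ?_ ?_ ?_
    · rintro ⟨i, σ⟩ hσ ⟨i', σ'⟩ hσ' he
      simp only [Finset.mem_sigma, Finset.mem_univ, true_and, Finset.mem_filter] at hσ hσ' he
      have h1 : σ = σ' := by rw [hσ.eq_sort, hσ'.eq_sort, he]
      have h2 := congrArg List.length (hσ.ofFn_first (by omega))
      rw [he, ← hσ'.ofFn_first (by omega), List.length_ofFn, List.length_ofFn] at h2
      rw [h1, Fin.ext h2]
    · intro c _
      obtain ⟨i, hi, σ, hσ, he⟩ := exists_shuffle_firstSel_eq c
      exact ⟨⟨⟨i, by omega⟩, σ⟩, by simpa using hσ, he⟩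
    · rintro ⟨i, σ⟩ hσ
      simp only [Finset.mem_sigma, Finset.mem_univ, true_and, Finset.mem_filter] at hσ
      have hi : (i : ℕ) ≤ N := by omega
      rw [hσ.koszulSign_eq, hl, hl, List.ofFn_cons, ← hσ.ofFn_first hi, ← hσ.ofFn_last hi,
        List.map_ofFn, List.map_ofFn]
      rfl

end voronov

/-! ### Weights on `𝔤`. -/

namespace Gerst

section spans

variable {K V W : Type*} [Field K] [AddCommGroup V] [Module K V] [AddCommGroup W] [Module K W]

/-- The span in `⨁_n Hom(V^{⊗ n+1}, W)` of multilinear maps from given submodules. -/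
def spanOf (S : (n : ℕ) → Submodule K (MultilinearMap K (fun _ : Fin n => V) W)) :
    Submodule K (GradedHom K V W) :=
  ⨆ n, (S (n + 1)).map (GradedHom.of K V W n)

theorem of_mem_spanOf {S : (n : ℕ) → Submodule K (MultilinearMap K (fun _ : Fin n => V) W)}
    {n : ℕ} {f : MultilinearMap K (fun _ : Fin (n + 1) => V) W} (h : f ∈ S (n + 1)) :
    GradedHom.of K V W n f ∈ spanOf S :=
  Submodule.mem_iSup_of_mem n ⟨f, h, rfl⟩

theorem spanOf_le {S : (n : ℕ) → Submodule K (MultilinearMap K (fun _ : Fin n => V) W)}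
    {P : Submodule K (GradedHom K V W)}
    (h : ∀ n, ∀ f ∈ S (n + 1), GradedHom.of K V W n f ∈ P) : spanOf S ≤ P :=
  iSup_le fun n => by rintro _ ⟨f, hf, rfl⟩; exact h n f hf

theorem mem_of_forall_of_mem {P : Submodule K (GradedHom K V W)}
    (h : ∀ n f, GradedHom.of K V W n f ∈ P) (x : GradedHom K V W) : x ∈ P := by
  have hx : x ∈ ⨆ n, LinearMap.range (GradedHom.of K V W n) := by
    rw [GradedHom.iSup_range_of]; trivial
  exact (iSup_le fun n => by rintro _ ⟨f, rfl⟩; exact h n f :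
    (⨆ n, LinearMap.range (GradedHom.of K V W n)) ≤ P) hx

/-- The bracket is a signed sum of insertions in both orders, so closure under insertion suffices
and signs play no role. -/
theorem bracket_mem_spanOf
    {S T U : (n : ℕ) → Submodule K (MultilinearMap K (fun _ : Fin n => V) V)}
    (h : ∀ {m k N : ℕ} (f : MultilinearMap K (fun _ : Fin m => V) V)
      (g : MultilinearMap K (fun _ : Fin k => V) V) (i : Fin m) (e : m + k = N + 1),
      f ∈ S m → g ∈ T k → insertion f g i e ∈ U N)
    (h' : ∀ {m k N : ℕ} (f : MultilinearMap K (fun _ : Fin m => V) V)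
      (g : MultilinearMap K (fun _ : Fin k => V) V) (i : Fin m) (e : m + k = N + 1),
      f ∈ T m → g ∈ S k → insertion f g i e ∈ U N)
    {x y : GradedHom K V V} (hx : x ∈ spanOf S) (hy : y ∈ spanOf T) :
    bracket K V x y ∈ spanOf U := by
  have h1 : spanOf S ≤ (spanOf U).comap ((bracket K V).flip y) := by
    refine spanOf_le fun p f hf => ?_
    have h2 : spanOf T ≤ (spanOf U).comap (bracket K V (GradedHom.of K V V p f)) := by
      refine spanOf_le fun q g hg => ?_
      rw [Submodule.mem_comap, bracket_of]
      refine sub_mem (of_mem_spanOf ?_) (Submodule.smul_mem _ _ (of_mem_spanOf ?_))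
      · rw [diamond_apply]
        exact sum_mem fun i _ => Submodule.smul_mem _ _ (h _ _ _ _ hf hg)
      · rw [diamond_apply]
        exact sum_mem fun i _ => Submodule.smul_mem _ _ (h' _ _ _ _ hg hf)
    exact h2 hy
  exact h1 hx

end spans

section weights

variable {K A B : Type*} [Field K] [AddCommGroup A] [Module K A] [AddCommGroup B] [Module K B]

/-- Homogeneity for the grading of `A × B` with `A` in degree `1` and `B` in degree `0`. -/
def IsPure (c : ℤ) (v : A × B) : Prop := (c ≠ 1 → v.1 = 0) ∧ (c ≠ 0 → v.2 = 0)

theorem IsPure.cases {c : ℤ} {v : A × B} (h : IsPure c v) :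
    v = 0 ∨ (c = 1 ∧ v.2 = 0) ∨ (c = 0 ∧ v.1 = 0) := by
  by_cases h1 : c = 1
  · exact Or.inr (Or.inl ⟨h1, h.2 (by omega)⟩)
  by_cases h0 : c = 0
  · exact Or.inr (Or.inr ⟨h0, h.1 h1⟩)
  · exact Or.inl (Prod.ext (h.1 h1) (h.2 h0))

theorem isPure_inl (a : A) : IsPure 1 ((a, 0) : A × B) := ⟨fun h => (h rfl).elim, fun _ => rfl⟩

theorem isPure_inr (x : B) : IsPure 0 ((0, x) : A × B) := ⟨fun _ => rfl, fun h => (h rfl).elim⟩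

variable (K A B) in
/-- The multilinear maps which lower the degree by `w`. -/
def weightMaps (w : ℤ) (n : ℕ) :
    Submodule K (MultilinearMap K (fun _ : Fin n => A × B) (A × B)) where
  carrier := {f | ∀ (c : Fin n → ℤ) (v : Fin n → A × B), (∀ j, IsPure (c j) (v j)) →
    IsPure ((∑ j, c j) - w) (f v)}
  zero_mem' _ _ _ := ⟨fun _ => rfl, fun _ => rfl⟩
  add_mem' {f g} hf hg c v hv :=
    ⟨fun h => by simp [(hf c v hv).1 h, (hg c v hv).1 h],
      fun h => by simp [(hf c v hv).2 h, (hg c v hv).2 h]⟩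
  smul_mem' t f hf c v hv :=
    ⟨fun h => by simp [(hf c v hv).1 h], fun h => by simp [(hf c v hv).2 h]⟩

variable (K A B) in
/-- The elements of `𝔤` of weight `w`. -/
def weight (w : ℤ) : Submodule K (GSpace K A B) := spanOf (weightMaps K A B w)

theorem sum_insertArgs_degrees {m k N : ℕ} (i : Fin m) (e : m + k = N + 1) (c : ℕ → ℤ) (w : ℤ) :
    ∑ j : Fin m, (if (j : ℕ) < i then c j
        else if (j : ℕ) = i then (∑ t : Fin k, c (i + t)) - w else c (j + k - 1))
      = (∑ j : Fin N, c j) - w := by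
  rw [← Finset.sum_range (fun j => c j), ← Finset.sum_range (fun t => c (i + t)),
    ← Finset.sum_range (fun j : ℕ => if j < i then c j
        else if j = i then (∑ t ∈ Finset.range k, c (i + t)) - w else c (j + k - 1))]
  obtain ⟨i, hi⟩ := i
  obtain ⟨s, rfl⟩ : ∃ s, m = i + 1 + s := ⟨m - (i + 1), by omega⟩
  obtain rfl : N = i + k + s := by omega
  simp only
  rw [Finset.sum_range_add, Finset.sum_range_succ, Finset.sum_range_add, Finset.sum_range_add]
  have e1 : ∀ j ∈ Finset.range i, (if j < i then c j
        else if j = i then (∑ t ∈ Finset.range k, c (i + t)) - w else c (j + k - 1)) = c j :=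
    fun j hj => if_pos (Finset.mem_range.1 hj)
  have e2 : ∀ j ∈ Finset.range s, (if i + 1 + j < i then c (i + 1 + j)
        else if i + 1 + j = i then (∑ t ∈ Finset.range k, c (i + t)) - w
        else c (i + 1 + j + k - 1)) = c (i + k + j) := fun j _ => by
    rw [if_neg (by omega), if_neg (by omega)]
    congr 1; omega
  rw [Finset.sum_congr rfl e1, Finset.sum_congr rfl e2, if_neg (lt_irrefl i), if_pos rfl]
  ring

theorem insertion_mem_weightMaps {w w' u : ℤ} (hu : u = w + w') {m k N : ℕ}
    (f : MultilinearMap K (fun _ : Fin m => A × B) (A × B))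
    (g : MultilinearMap K (fun _ : Fin k => A × B) (A × B)) (i : Fin m) (e : m + k = N + 1)
    (hf : f ∈ weightMaps K A B w m) (hg : g ∈ weightMaps K A B w' k) :
    insertion f g i e ∈ weightMaps K A B u N := by
  intro c v hv
  -- Extending the degrees by `0` to all of `ℕ` lets the arguments of `f` be indexed without bound
  -- proofs.
  let c' : ℕ → ℤ := fun j => if h : j < N then c ⟨j, h⟩ else 0
  have hc : ∀ j (h : j < N), c' j = c ⟨j, h⟩ := fun j h => dif_pos h
  have hs : ∑ j, c j = ∑ j : Fin N, c' j := Finset.sum_congr rfl fun j _ => (hc j j.2).symm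
  have hp : ∀ j (h : j < N), IsPure (c' j) (v ⟨j, h⟩) := fun j h => hc j h ▸ hv _
  have := hf _ (insertArgs g i e v) (fun j => (?_ : IsPure (if (j : ℕ) < i then c' j
    else if (j : ℕ) = i then (∑ t : Fin k, c' (i + t)) - w' else c' (j + k - 1)) _))
  · rw [sum_insertArgs_degrees i e c' w', ← hs, sub_sub, add_comm w', ← hu] at this
    exact this
  · unfold insertArgs
    split_ifs
    · exact hp _ _
    · exact hg _ _ fun t => hp _ _
    · exact hp _ _

theorem bracket_mem_weight {w w' u : ℤ} (hu : u = w + w') {x y : GSpace K A B}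
    (hx : x ∈ weight K A B w) (hy : y ∈ weight K A B w') :
    bracket K (A × B) x y ∈ weight K A B u :=
  bracket_mem_spanOf (fun f g i e => insertion_mem_weightMaps hu f g i e)
    (fun f g i e => insertion_mem_weightMaps (hu.trans (add_comm _ _)) f g i e) hx hy

theorem multilinear_eq_zero_of_pure {n : ℕ} {W : Type*} [AddCommGroup W] [Module K W]
    (f : MultilinearMap K (fun _ : Fin n => A × B) W)
    (h : ∀ (s : Finset (Fin n)) (a : Fin n → A) (x : Fin n → B),
      f (s.piecewise (fun j => (a j, 0)) (fun j => (0, x j))) = 0) : f = 0 := by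
  ext v
  have : v = (fun j => ((v j).1, (0 : B))) + (fun j => ((0 : A), (v j).2)) := by
    funext j; simp
  rw [this, MultilinearMap.map_add_univ]
  exact Finset.sum_eq_zero fun s _ => h s _ _

theorem isPure_piecewise {n : ℕ} (s : Finset (Fin n)) (a : Fin n → A) (x : Fin n → B) (j : Fin n) :
    IsPure (if j ∈ s then 1 else 0)
      (s.piecewise (fun j => (a j, (0 : B))) (fun j => ((0 : A), x j)) j) := by
  by_cases h : j ∈ s
  · rw [if_pos h, Finset.piecewise_eq_of_mem _ _ _ h]; exact isPure_inl _
  · rw [if_neg h, Finset.piecewise_eq_of_notMem _ _ _ h]; exact isPure_inr _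

theorem sum_indicator {n : ℕ} (s : Finset (Fin n)) :
    (∑ j, if j ∈ s then (1 : ℤ) else 0) = s.card := by simp

/-- Inputs have degree at least `0`, so outputs would have degree at least `-w > 1`, where `A × B`
vanishes. -/
theorem weight_eq_zero {w : ℤ} (hw : w < -1) {y : GSpace K A B} (hy : y ∈ weight K A B w) :
    y = 0 := by
  have : weight K A B w ≤ ⊥ := spanOf_le fun n f hf => by
    rw [multilinear_eq_zero_of_pure f fun s a x => ?_, map_zero]
    · exact zero_mem _
    · have := hf _ _ (isPure_piecewise s a x)
      rw [sum_indicator] at this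
      exact Prod.ext (this.1 (by omega)) (this.2 (by omega))
  exact (Submodule.mem_bot K).1 (this hy)

end weights

end Gerst

/-! ### The subspace `𝔟`, its projection, and Voronov's conditions. -/

namespace BSpace

variable {K A B : Type*} [Field K] [AddCommGroup A] [Module K A] [AddCommGroup B] [Module K B]

open Gerst

theorem incl_of (n : ℕ) (f : MultilinearMap K (fun _ : Fin (n + 1) => B) A) :
    incl K A B (GradedHom.of K B A n f) = GradedHom.of K (A × B) (A × B) n
      ((LinearMap.inl K A B).compMultilinearMap
        (f.compLinearMap fun _ => LinearMap.snd K A B)) := by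
  rw [incl, GradedHom.lift_of]
  rfl

theorem proj_of (n : ℕ) (f : MultilinearMap K (fun _ : Fin (n + 1) => A × B) (A × B)) :
    proj K A B (GradedHom.of K (A × B) (A × B) n f) = GradedHom.of K B A n
      ((LinearMap.fst K A B).compMultilinearMap
        (f.compLinearMap fun _ => LinearMap.inr K A B)) := by
  rw [proj, GradedHom.lift_of]
  rfl

theorem proj_incl (x : BSpace K A B) : proj K A B (incl K A B x) = x := by
  have : proj K A B ∘ₗ incl K A B = LinearMap.id := GradedHom.linearMap_ext fun n f => by
    rw [LinearMap.comp_apply, incl_of, proj_of]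
    rfl
  exact LinearMap.congr_fun this x

/-- On inputs from `B`, of degree `0`, the output has degree `-w`; an `A`-component requires `-w =
1`. -/
theorem proj_eq_zero_of_weight {w : ℤ} (hw : w ≠ -1) {y : GSpace K A B}
    (hy : y ∈ weight K A B w) : proj K A B y = 0 := by
  have : weight K A B w ≤ LinearMap.ker (proj K A B) := spanOf_le fun n f hf => by
    rw [LinearMap.mem_ker, proj_of]
    refine (congrArg _ (MultilinearMap.ext fun x => ?_)).trans (map_zero (GradedHom.of K B A n))
    exact (hf (fun _ => 0) _ (fun j => isPure_inr (x j))).1 (by simp; omega)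
  exact this hy

/-- Weight `-1` characterizes `𝔟`: an input from `A` would push the output to degree at least `2`,
and with all inputs in `B` the output has degree `1`, so lies in `A`. -/
theorem incl_proj_of_weight {y : GSpace K A B} (hy : y ∈ weight K A B (-1)) :
    incl K A B (proj K A B y) = y := by
  have : weight K A B (-1) ≤ LinearMap.eqLocus (incl K A B ∘ₗ proj K A B) LinearMap.id := by
    refine spanOf_le fun n f hf => ?_
    rw [LinearMap.mem_eqLocus, LinearMap.comp_apply, proj_of, incl_of, LinearMap.id_apply]
    congr 1
    rw [← sub_eq_zero]
    refine multilinear_eq_zero_of_pure _ fun s a x => ?_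
    have hp := hf _ _ (isPure_piecewise s a x)
    rw [sum_indicator] at hp
    rw [sub_apply, sub_eq_zero]
    rcases s.eq_empty_or_nonempty with rfl | ⟨j, hj⟩
    · refine Prod.ext ?_ (hp.2 (by simp)).symm
      simp
    · have hc : 0 < s.card := Finset.card_pos.2 ⟨j, hj⟩
      have h1 : f (s.piecewise (fun j => (a j, 0)) (fun j => (0, x j))) = 0 :=
        Prod.ext (hp.1 (by omega)) (hp.2 (by omega))
      rw [h1]
      simp only [LinearMap.compMultilinearMap_apply, MultilinearMap.compLinearMap_apply]
      rw [MultilinearMap.map_coord_zero f j, map_zero, map_zero]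
      simp [hj]
  exact this hy

theorem incl_mem_weight (x : BSpace K A B) : incl K A B x ∈ weight K A B (-1) := by
  refine mem_of_forall_of_mem (P := (weight K A B (-1)).comap (incl K A B)) (fun n f => ?_) x
  rw [Submodule.mem_comap, incl_of]
  refine of_mem_spanOf fun c v hv => ⟨fun h => ?_, fun _ => rfl⟩
  by_contra hne
  have h0 : ∀ j, c j = 0 := fun j => by
    by_contra hj
    exact hne (f.map_coord_zero j ((hv j).2 hj))
  exact h (by simp [h0])

/-- The multilinear maps for which `B` is a subalgebra. -/
def subalgebraMaps (K A B : Type*) [Field K] [AddCommGroup A] [Module K A] [AddCommGroup B]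
    [Module K B] (n : ℕ) : Submodule K (MultilinearMap K (fun _ : Fin n => A × B) (A × B)) where
  carrier := {f | ∀ x : Fin n → B, (f fun j => (0, x j)).1 = 0}
  zero_mem' _ := rfl
  add_mem' {f g} hf hg x := by
    simp only [Set.mem_ofPred_eq] at hf hg
    simp [hf x, hg x]
  smul_mem' t f hf x := by
    simp only [Set.mem_ofPred_eq] at hf
    simp [hf x]

/-- As `y` need not be homogeneous, apply `id - incl ∘ proj`: it fixes the kernel of `proj` and
sends each homogeneous map to one that preserves `B`. -/
theorem mem_spanOf_subalgebraMaps {y : GSpace K A B} (hy : proj K A B y = 0) :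
    y ∈ spanOf (subalgebraMaps K A B) := by
  have := mem_of_forall_of_mem (P := (spanOf (subalgebraMaps K A B)).comap
    (LinearMap.id - incl K A B ∘ₗ proj K A B)) (fun n f => ?_) y
  · simpa [hy] using this
  · rw [Submodule.mem_comap, LinearMap.sub_apply, LinearMap.comp_apply, proj_of, incl_of,
      LinearMap.id_apply, ← map_sub]
    refine of_mem_spanOf fun x => ?_
    simp

theorem proj_eq_zero_of_mem {y : GSpace K A B} (hy : y ∈ spanOf (subalgebraMaps K A B)) :
    proj K A B y = 0 := by
  have : spanOf (subalgebraMaps K A B) ≤ LinearMap.ker (proj K A B) := spanOf_le fun n f hf => by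
    rw [LinearMap.mem_ker, proj_of]
    refine (congrArg _ (MultilinearMap.ext fun x => ?_)).trans (map_zero (GradedHom.of K B A n))
    exact hf x
  exact this hy

theorem insertion_mem_subalgebraMaps {m k N : ℕ}
    (f : MultilinearMap K (fun _ : Fin m => A × B) (A × B))
    (g : MultilinearMap K (fun _ : Fin k => A × B) (A × B)) (i : Fin m) (e : m + k = N + 1)
    (hf : f ∈ subalgebraMaps K A B m) (hg : g ∈ subalgebraMaps K A B k) :
    insertion f g i e ∈ subalgebraMaps K A B N := by
  intro x
  have : insertArgs g i e (fun j => ((0 : A), x j))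
      = fun j => (0, (insertArgs g i e (fun j => ((0 : A), x j)) j).2) := by
    funext j
    refine Prod.ext ?_ rfl
    simp only [insertArgs]
    split_ifs
    · rfl
    · exact hg _
    · rfl
  change (f _).1 = 0
  rw [this]
  exact hf _

theorem proj_bracket_eq_zero {a b : GSpace K A B} (ha : proj K A B a = 0)
    (hb : proj K A B b = 0) : proj K A B (bracket K (A × B) a b) = 0 :=
  proj_eq_zero_of_mem (bracket_mem_spanOf insertion_mem_subalgebraMaps
    insertion_mem_subalgebraMaps (mem_spanOf_subalgebraMaps ha) (mem_spanOf_subalgebraMaps hb))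

variable (K A B) in
theorem isVoronovData : IsVoronovData (GradedHom.grading K (A × B) (A × B)) (grading K A B)
    (bracket K (A × B)) (incl K A B) (proj K A B) where
  bracket_mem {p q a b} ha hb := by
    rcases GradedHom.eq_zero_or_of_mem_grading ha with rfl | ⟨p, rfl, f, rfl⟩
    · simp
    rcases GradedHom.eq_zero_or_of_mem_grading hb with rfl | ⟨q, rfl, g, rfl⟩
    · simp
    rw [bracket_of]
    exact sub_mem (GradedHom.of_mem_grading _ _ (by push_cast; ring))
      (Submodule.smul_mem _ _ (GradedHom.of_mem_grading _ _ (by push_cast; ring)))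
  skew {p q a b} ha hb := by
    rcases GradedHom.eq_zero_or_of_mem_grading ha with rfl | ⟨p, rfl, f, rfl⟩
    · simp
    rcases GradedHom.eq_zero_or_of_mem_grading hb with rfl | ⟨q, rfl, g, rfl⟩
    · simp
    rw [bracket_of, bracket_of, ← Nat.cast_mul, parity_natCast_smul (K := K), mul_comm q p,
      smul_sub, smul_smul, ← pow_add, (Even.add_self _).neg_one_pow, one_smul, neg_sub]
  leibniz {p q s a b c} ha hb hc := by
    rcases GradedHom.eq_zero_or_of_mem_grading ha with rfl | ⟨p, rfl, f, rfl⟩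
    · simp
    rcases GradedHom.eq_zero_or_of_mem_grading hb with rfl | ⟨q, rfl, g, rfl⟩
    · simp
    rcases GradedHom.eq_zero_or_of_mem_grading hc with rfl | ⟨s, rfl, h, rfl⟩
    · simp
    rw [bracket_leibniz_of, ← Nat.cast_mul, parity_natCast_smul (K := K)]
  incl_mem {d x} hx := by
    rcases GradedHom.eq_zero_or_of_mem_grading hx with rfl | ⟨p, rfl, f, rfl⟩
    · simp
    rw [incl_of]
    exact GradedHom.of_mem_grading _ _ rfl
  proj_mem {d a} ha := by
    rcases GradedHom.eq_zero_or_of_mem_grading ha with rfl | ⟨p, rfl, f, rfl⟩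
    · simp
    rw [proj_of]
    exact GradedHom.of_mem_grading _ _ rfl
  proj_incl := proj_incl
  -- The bracket of two elements of `𝔟` has weight `-2`, and there is nothing of that weight.
  abelian x y := weight_eq_zero (w := -2) (by norm_num)
    (bracket_mem_weight (by norm_num) (incl_mem_weight x) (incl_mem_weight y))
  ker_subalgebra := proj_bracket_eq_zero

theorem iteratedBracket_eq_nested (k : ℕ) (Δ : GSpace K A B) (x : Fin k → BSpace K A B) :
    iteratedBracket K A B k Δ x
      = nested (bracket K (A × B)) (incl K A B) (List.ofFn x) Δ := by
  induction k generalizing Δ with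
  | zero => rfl
  | succ k ih =>
    rw [List.ofFn_succ, IsVoronovData.nested_cons, ← ih]
    rfl

theorem nested_mem_weight (L : List (BSpace K A B)) {w : ℤ} {a : GSpace K A B}
    (ha : a ∈ weight K A B w) :
    nested (bracket K (A × B)) (incl K A B) L a ∈ weight K A B (w - L.length) := by
  induction L generalizing w a with
  | nil => simpa [nested] using ha
  | cons x L ih =>
    have := ih (bracket_mem_weight rfl ha (incl_mem_weight x))
    rw [IsVoronovData.nested_cons]
    convert this using 2
    rw [List.length_cons]; push_cast; ring

theorem iteratedBracket_mem_weight (k : ℕ) {w : ℤ} {a : GSpace K A B} (ha : a ∈ weight K A B w)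
    (x : Fin k → BSpace K A B) : iteratedBracket K A B k a x ∈ weight K A B (w - k) := by
  have := nested_mem_weight (List.ofFn x) ha
  rwa [← iteratedBracket_eq_nested, List.length_ofFn] at this

end BSpace

/-! ### The product on `A × B` and its transport along the shear by `r`. -/

section pairMul

variable {K A B : Type*} [Field K] [AddCommGroup A] [Module K A] [AddCommGroup B] [Module K B]

/-- The multiplication on `A × B` with the given components. -/
def pairMul (mulA : A →ₗ[K] A →ₗ[K] A) (mulB : B →ₗ[K] B →ₗ[K] B) (tri : A →ₗ[K] B →ₗ[K] B)
    (ltri : B →ₗ[K] A →ₗ[K] B) (rharp : B →ₗ[K] A →ₗ[K] A) (lharp : A →ₗ[K] B →ₗ[K] A)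
    (theta : A →ₗ[K] A →ₗ[K] B) (u v : A × B) : A × B :=
  (mulA u.1 v.1 + lharp u.1 v.2 + rharp u.2 v.1,
    mulB u.2 v.2 + tri u.1 v.2 + ltri u.2 v.1 + theta u.1 v.1)

namespace QuasiTwilled

/-- The components of an associative multiplication on `A × B` for which `B` is a subalgebra form
a quasi-twilled associative algebra. -/
def ofAssoc (mulA : A →ₗ[K] A →ₗ[K] A) (mulB : B →ₗ[K] B →ₗ[K] B) (tri : A →ₗ[K] B →ₗ[K] B)
    (ltri : B →ₗ[K] A →ₗ[K] B) (rharp : B →ₗ[K] A →ₗ[K] A) (lharp : A →ₗ[K] B →ₗ[K] A)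
    (theta : A →ₗ[K] A →ₗ[K] B)
    (h : ∀ u v w, pairMul mulA mulB tri ltri rharp lharp theta
        (pairMul mulA mulB tri ltri rharp lharp theta u v) w
      = pairMul mulA mulB tri ltri rharp lharp theta u
        (pairMul mulA mulB tri ltri rharp lharp theta v w)) : QuasiTwilled K A B where
  mulA := mulA
  mulB := mulB
  tri := tri
  ltri := ltri
  rharp := rharp
  lharp := lharp
  theta := theta
  assocB x y z := by simpa [pairMul] using congrArg Prod.snd (h (0, x) (0, y) (0, z))
  bimod_left x y a := by simpa [pairMul] using congrArg Prod.fst (h (0, x) (0, y) (a, 0))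
  bimod_mid x a y := by simpa [pairMul] using congrArg Prod.fst (h (0, x) (a, 0) (0, y))
  bimod_right a x y := by simpa [pairMul] using congrArg Prod.fst (h (a, 0) (0, x) (0, y))
  compat1 a b c := by simpa [pairMul] using (congrArg Prod.fst (h (a, 0) (b, 0) (c, 0))).symm
  compat2 a b x := by
    simpa [pairMul, add_comm] using congrArg Prod.snd (h (a, 0) (b, 0) (0, x))
  compat3 x a b := by
    simpa [pairMul, add_comm] using (congrArg Prod.snd (h (0, x) (a, 0) (b, 0))).symm
  compat4 a x b := by
    simpa [pairMul, add_comm] using (congrArg Prod.snd (h (a, 0) (0, x) (b, 0))).symm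
  compat5 a x y := by
    simpa [pairMul, add_comm] using (congrArg Prod.snd (h (a, 0) (0, x) (0, y))).symm
  compat6 x y a := by
    simpa [pairMul, add_comm] using congrArg Prod.snd (h (0, x) (0, y) (a, 0))
  compat7 x a y := by
    simpa [pairMul, add_comm] using (congrArg Prod.snd (h (0, x) (a, 0) (0, y))).symm
  compat8 x a b := by
    simpa [pairMul, add_comm] using (congrArg Prod.fst (h (0, x) (a, 0) (b, 0))).symm
  compat9 a b x := by
    simpa [pairMul, add_comm] using congrArg Prod.fst (h (a, 0) (b, 0) (0, x))
  compat10 a x b := by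
    simpa [pairMul, add_comm] using (congrArg Prod.fst (h (a, 0) (0, x) (b, 0))).symm
  compat11 a b c := by
    simpa [pairMul, add_comm] using (congrArg Prod.snd (h (a, 0) (b, 0) (c, 0))).symm

variable (Q : QuasiTwilled K A B)

/-- The multiplication on `A × B`. -/
def mul (u v : A × B) : A × B :=
  pairMul Q.mulA Q.mulB Q.tri Q.ltri Q.rharp Q.lharp Q.theta u v

/-- The fifteen axioms are the components of associativity, one for each choice of `A` or `B` for
the three factors and the output; the `A`-output of three factors in `B` is void because `B` is a
subalgebra. -/
theorem mul_assoc (u v w : A × B) : Q.mul (Q.mul u v) w = Q.mul u (Q.mul v w) := by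
  obtain ⟨a, x⟩ := u
  obtain ⟨b, y⟩ := v
  obtain ⟨c, z⟩ := w
  refine Prod.ext ?_ ?_
  · simp only [mul, pairMul, map_add, LinearMap.add_apply]
    linear_combination (norm := module) Q.bimod_left x y c + Q.bimod_mid x b z
      + Q.bimod_right a y z - Q.compat1 a b c - Q.compat8 x b c + Q.compat9 a b z
      - Q.compat10 a y c
  · simp only [mul, pairMul, map_add, LinearMap.add_apply]
    linear_combination (norm := module) Q.assocB x y z + Q.compat2 a b z - Q.compat3 x b c
      - Q.compat4 a y c - Q.compat5 a y z + Q.compat6 x y c - Q.compat7 x b z - Q.compat11 a b c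

/-- `a ·_A b - r(θ(a, b))`. -/
def mulAr (r : B →ₗ[K] A) : A →ₗ[K] A →ₗ[K] A := Q.mulA - Q.theta.compr₂ r

/-- `a ▷ x + θ(a, r(x))`. -/
def trir (r : B →ₗ[K] A) : A →ₗ[K] B →ₗ[K] B := Q.tri + Q.theta.compl₁₂ LinearMap.id r

/-- `x ◁ a + θ(r(x), a)`. -/
def ltrir (r : B →ₗ[K] A) : B →ₗ[K] A →ₗ[K] B := Q.ltri + Q.theta.compl₁₂ r LinearMap.id

/-- The automorphism `(a, x) ↦ (a + r(x), x)` of the vector space `A × B`. -/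
def shear (r : B →ₗ[K] A) (u : A × B) : A × B := (u.1 + r u.2, u.2)

theorem shear_injective (r : B →ₗ[K] A) : Function.Injective (shear r) := by
  intro u v h
  have h2 : u.2 = v.2 := (Prod.ext_iff.1 h).2
  have h1 : u.1 + r u.2 = v.1 + r v.2 := (Prod.ext_iff.1 h).1
  rw [h2] at h1
  exact Prod.ext (add_right_cancel h1) h2

/-- The operations with index `r` are the components of the product conjugated by the shear. The
conjugate could also have a component `B × B → A`, and that is the defect of the deformation
equation at `r`, which vanishes by `hr`. -/
theorem shear_pairMul {Q : QuasiTwilled K A B} {r : B →ₗ[K] A} (hr : Q.IsWeakDeformationMap r) (u v : A × B) :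
    shear r (pairMul (Q.mulAr r) (Q.mulBr r) (Q.trir r) (Q.ltrir r) (Q.rharpr r) (Q.lharpr r)
      Q.theta u v) = Q.mul (shear r u) (shear r v) := by
  obtain ⟨a, x⟩ := u
  obtain ⟨b, y⟩ := v
  have := hr x y
  refine Prod.ext ?_ ?_
  · simp [mul, pairMul, shear, mulAr, mulBr, trir, ltrir, rharpr, lharpr] at this ⊢
    linear_combination (norm := module) -this
  · simp [mul, pairMul, shear, mulAr, mulBr, trir, ltrir, rharpr, lharpr]
    abel

/-- The quasi-twilled algebra obtained from `Q` by transport along `shear r`. -/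
def twist {Q : QuasiTwilled K A B} {r : B →ₗ[K] A} (hr : Q.IsWeakDeformationMap r) :
    QuasiTwilled K A B :=
  ofAssoc (Q.mulAr r) (Q.mulBr r) (Q.trir r) (Q.ltrir r) (Q.rharpr r) (Q.lharpr r) Q.theta
    fun u v w => shear_injective r (by simp only [shear_pairMul hr, mul_assoc])

/-- A weak deformation map is one whose graph is a subalgebra, and the shear by `r` carries the
graph of `s` to that of `r + s`. In formulas, the two defects differ by the defect of `r`. -/
theorem isWeakDeformationMap_twist_iff {Q : QuasiTwilled K A B} {r : B →ₗ[K] A}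
    (hr : Q.IsWeakDeformationMap r) (s : B →ₗ[K] A) :
    (twist hr).IsWeakDeformationMap s ↔ Q.IsWeakDeformationMap (r + s) := by
  refine forall₂_congr fun x y => ?_
  have := hr x y
  simp only [twist, ofAssoc, mulAr, mulBr, trir, ltrir, rharpr, lharpr, LinearMap.add_apply,
    LinearMap.sub_apply, LinearMap.compl₁₂_apply, LinearMap.compr₂_apply, LinearMap.id_apply,
    map_add] at this ⊢
  rw [← sub_eq_zero, ← sub_eq_zero (b := _ + _)]
  refine Eq.congr ?_ rfl
  linear_combination (norm := module) -this

end QuasiTwilled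

end pairMul

/-! ### The total element and the operations `l` as derived brackets. -/

section elements

variable {K A B : Type*} [Field K] [AddCommGroup A] [Module K A] [AddCommGroup B] [Module K B]

open Gerst

/-- The product `m ⋄ m` is the associator of `m`. -/
theorem bracket_self_of_assoc {V : Type*} [AddCommGroup V] [Module K V] (m : V →ₗ[K] V →ₗ[K] V)
    (hm : ∀ u v w, m (m u v) w = m u (m v w)) :
    bracket K V (GradedHom.of K V V 1 (bilinToMultilin m))
      (GradedHom.of K V V 1 (bilinToMultilin m)) = 0 := by
  have : diamond K V 1 1 (bilinToMultilin m) (bilinToMultilin m) = 0 := by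
    refine ext_evalSeq fun a => ?_
    rw [evalSeq_diamond]
    have e : ∀ b, evalSeq (bilinToMultilin m) b = m (b 0) (b 1) := fun b => rfl
    have e0 : evalSeq (0 : MultilinearMap K (fun _ : Fin (1 + 1 + 1) => V) V) a = 0 := rfl
    rw [e0]
    simp [Finset.sum_range_succ, e, insertSeq, hm]
  rw [bracket_of, this, map_zero, smul_zero, sub_zero]

/-- `(u, v) ↦ β(s u, v) + β(u, s v) - s β(u, v)`. -/
def bilinDerive {V : Type*} [AddCommGroup V] [Module K V] (β : V →ₗ[K] V →ₗ[K] V)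
    (s : V →ₗ[K] V) : V →ₗ[K] V →ₗ[K] V :=
  β.compl₁₂ s LinearMap.id + β.compl₁₂ LinearMap.id s - β.compr₂ s

theorem bracket_bilin_linear {V : Type*} [AddCommGroup V] [Module K V] (β : V →ₗ[K] V →ₗ[K] V)
    (s : V →ₗ[K] V) :
    bracket K V (GradedHom.of K V V 1 (bilinToMultilin β))
        (GradedHom.of K V V 0 (MultilinearMap.ofSubsingleton K V V (0 : Fin 1) s))
      = GradedHom.of K V V 1 (bilinToMultilin (bilinDerive β s)) := by
  have e : ∀ (β : V →ₗ[K] V →ₗ[K] V) b, evalSeq (bilinToMultilin β) b = β (b 0) (b 1) :=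
    fun β b => rfl
  have e' : ∀ b, evalSeq (MultilinearMap.ofSubsingleton K V V (0 : Fin 1) s) b = s (b 0) :=
    fun b => rfl
  rw [bracket_of, GradedHom.of_congr (zero_add 1) (f := diamond K V 0 1 _ _)
    (g := bilinToMultilin (β.compr₂ s))
    (fun a => by rw [evalSeq_diamond]; simp [e, e', insertSeq])]
  rw [mul_zero, pow_zero, one_smul]
  change GradedHom.of K V V 1 _ - _ = _
  rw [← map_sub]
  refine congrArg _ (ext_evalSeq fun a => ?_)
  change evalSeq (diamond K V 1 0 _ _) a - evalSeq (bilinToMultilin (β.compr₂ s)) a = _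
  rw [evalSeq_diamond]
  simp [Finset.sum_range_succ, e, e', insertSeq, bilinDerive]

namespace QuasiTwilled

variable (Q : QuasiTwilled K A B)

/-- The multiplication on `A × B` as an element of `𝔤_1`. -/
def totalElt : GSpace K A B := Q.nuElt + Q.muElt + Q.thetaElt

theorem bilinToMultilin_add {V W : Type*} [AddCommGroup V] [Module K V] [AddCommGroup W]
    [Module K W] (β γ : V →ₗ[K] V →ₗ[K] W) :
    bilinToMultilin (β + γ) = bilinToMultilin β + bilinToMultilin γ := rfl

theorem bilinToMultilin_smul {V W : Type*} [AddCommGroup V] [Module K V] [AddCommGroup W]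
    [Module K W] (c : K) (β : V →ₗ[K] V →ₗ[K] W) :
    bilinToMultilin (c • β) = c • bilinToMultilin β := rfl

theorem bracket_totalElt : bracket K (A × B) Q.totalElt Q.totalElt = 0 := by
  rw [totalElt, nuElt, muElt, thetaElt, ← map_add, ← map_add, ← bilinToMultilin_add,
    ← bilinToMultilin_add]
  refine bracket_self_of_assoc _ fun u v w => ?_
  have := Q.mul_assoc u v w
  have e : ∀ u v, (((Q.lharp.compl₁₂ (LinearMap.fst K A B) (LinearMap.snd K A B)
        + Q.rharp.compl₁₂ (LinearMap.snd K A B) (LinearMap.fst K A B)).compr₂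
          (LinearMap.inl K A B)
      + (Q.mulB.compl₁₂ (LinearMap.snd K A B) (LinearMap.snd K A B)).compr₂
          (LinearMap.inr K A B))
      + ((Q.mulA.compl₁₂ (LinearMap.fst K A B) (LinearMap.fst K A B)).compr₂ (LinearMap.inl K A B)
      + (Q.tri.compl₁₂ (LinearMap.fst K A B) (LinearMap.snd K A B)
        + Q.ltri.compl₁₂ (LinearMap.snd K A B) (LinearMap.fst K A B)).compr₂
          (LinearMap.inr K A B))
      + ((Q.theta.compl₁₂ (LinearMap.fst K A B) (LinearMap.fst K A B)).compr₂
      (LinearMap.inr K A B))) u v = Q.mul u v := fun u v => by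
    refine Prod.ext ?_ ?_ <;> simp [mul, pairMul] <;> abel
  rw [e, e, e, e, this]

theorem totalElt_mem : Q.totalElt ∈ GradedHom.grading K (A × B) (A × B) 1 :=
  add_mem (add_mem (GradedHom.of_mem_grading 1 _ rfl) (GradedHom.of_mem_grading 1 _ rfl))
    (GradedHom.of_mem_grading 1 _ rfl)

theorem nuElt_mem_weight : Q.nuElt ∈ weight K A B 0 := by
  refine of_mem_spanOf fun c v hv => ?_
  have h2 : ∑ j, c j = c 0 + c 1 := Fin.sum_univ_two c
  rw [h2]
  rcases (hv 0).cases with h0 | ⟨h0, h0'⟩ | ⟨h0, h0'⟩ <;>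
  rcases (hv 1).cases with h1 | ⟨h1, h1'⟩ | ⟨h1, h1'⟩ <;>
  simp [bilinToMultilin, IsPure, *]

theorem muElt_mem_weight : Q.muElt ∈ weight K A B 1 := by
  refine of_mem_spanOf fun c v hv => ?_
  have h2 : ∑ j, c j = c 0 + c 1 := Fin.sum_univ_two c
  rw [h2]
  rcases (hv 0).cases with h0 | ⟨h0, h0'⟩ | ⟨h0, h0'⟩ <;>
  rcases (hv 1).cases with h1 | ⟨h1, h1'⟩ | ⟨h1, h1'⟩ <;>
  simp [bilinToMultilin, IsPure, *]

theorem thetaElt_mem_weight : Q.thetaElt ∈ weight K A B 2 := by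
  refine of_mem_spanOf fun c v hv => ?_
  have h2 : ∑ j, c j = c 0 + c 1 := Fin.sum_univ_two c
  rw [h2]
  rcases (hv 0).cases with h0 | ⟨h0, h0'⟩ | ⟨h0, h0'⟩ <;>
  rcases (hv 1).cases with h1 | ⟨h1, h1'⟩ | ⟨h1, h1'⟩ <;>
  simp [bilinToMultilin, IsPure, *]

open BSpace

theorem l_eq_zero {k : ℕ} (hk : 4 ≤ k) : Q.l k = 0 := by
  obtain ⟨k, rfl⟩ := Nat.exists_eq_add_of_le' hk
  rfl

/-- After `k` brackets with `𝔟` the summands `ν`, `μ`, `θ~` have weights `-k`, `1 - k`, `2 - k`, and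
`proj` sees only weight `-1`. So at most one of them survives for each `k`, and none for `k = 0` or
`k ≥ 4`. -/
theorem l_eq_proj_nested (k : ℕ) (x : Fin k → BSpace K A B) :
    Q.l k x = proj K A B (nested (bracket K (A × B)) (incl K A B) (List.ofFn x) Q.totalElt) := by
  have hν := iteratedBracket_mem_weight k Q.nuElt_mem_weight x
  have hμ := iteratedBracket_mem_weight k Q.muElt_mem_weight x
  have hθ := iteratedBracket_mem_weight k Q.thetaElt_mem_weight x
  rw [totalElt, map_add, map_add, map_add, map_add, ← iteratedBracket_eq_nested,
    ← iteratedBracket_eq_nested, ← iteratedBracket_eq_nested]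
  match k with
  | 0 =>
    rw [proj_eq_zero_of_weight (by norm_num) hν, proj_eq_zero_of_weight (by norm_num) hμ,
      proj_eq_zero_of_weight (by norm_num) hθ, add_zero, add_zero]
    rfl
  | 1 =>
    rw [proj_eq_zero_of_weight (by norm_num) hμ, proj_eq_zero_of_weight (by norm_num) hθ,
      add_zero, add_zero]
    rfl
  | 2 =>
    rw [proj_eq_zero_of_weight (by norm_num) hν, proj_eq_zero_of_weight (by norm_num) hθ,
      zero_add, add_zero]
    rfl
  | 3 =>
    rw [proj_eq_zero_of_weight (by norm_num) hν, proj_eq_zero_of_weight (by norm_num) hμ,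
      zero_add, zero_add]
    rfl
  | k + 4 =>
    rw [proj_eq_zero_of_weight (by push_cast; omega) hν,
      proj_eq_zero_of_weight (by push_cast; omega) hμ,
      proj_eq_zero_of_weight (by push_cast; omega) hθ, add_zero, add_zero]
    rfl

theorem isLInfinity_l [CharZero K] : LInfty.IsLInfinity (grading K A B) Q.l where
  toIsCurvedLInfinity := (isVoronovData K A B).isCurvedLInfinity
    (GradedHom.isInternal_grading K B A) Q.totalElt_mem Q.bracket_totalElt Q.l Q.l_eq_proj_nested
  flat := rfl

theorem l_one (f : BSpace K A B) :
    Q.l 1 ![f] = proj K A B (bracket K (A × B) Q.nuElt (incl K A B f)) := rfl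

theorem l_two (f g : BSpace K A B) :
    Q.l 2 ![f, g] = proj K A B (bracket K (A × B)
      (bracket K (A × B) Q.muElt (incl K A B f)) (incl K A B g)) := rfl

theorem l_three (f g h : BSpace K A B) :
    Q.l 3 ![f, g, h] = proj K A B (bracket K (A × B) (bracket K (A × B)
      (bracket K (A × B) Q.thetaElt (incl K A B f)) (incl K A B g)) (incl K A B h)) := rfl

theorem incl_l_one (f : BSpace K A B) :
    incl K A B (Q.l 1 ![f]) = bracket K (A × B) Q.nuElt (incl K A B f) :=
  incl_proj_of_weight (iteratedBracket_mem_weight 1 Q.nuElt_mem_weight ![f])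

theorem incl_l_two (f g : BSpace K A B) :
    incl K A B (Q.l 2 ![f, g]) = bracket K (A × B)
      (bracket K (A × B) Q.muElt (incl K A B f)) (incl K A B g) :=
  incl_proj_of_weight (iteratedBracket_mem_weight 2 Q.muElt_mem_weight ![f, g])

theorem incl_l_three (f g h : BSpace K A B) :
    incl K A B (Q.l 3 ![f, g, h]) = bracket K (A × B) (bracket K (A × B)
      (bracket K (A × B) Q.thetaElt (incl K A B f)) (incl K A B g)) (incl K A B h) :=
  incl_proj_of_weight (iteratedBracket_mem_weight 3 Q.thetaElt_mem_weight ![f, g, h])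

end QuasiTwilled

end elements

/-! ### Weak filtrations when almost all operations vanish. -/

namespace LInfty

variable {K V : Type*} [Field K] [AddCommGroup V] [Module K V]

theorem hasFilteredSum_of_eventually_zero (F : ℕ → Submodule K V) {u : ℕ → V} {n : ℕ}
    (hu : ∀ k, n ≤ k → u k = 0) : HasFilteredSum F u (∑ j ∈ Finset.range n, u j) := by
  refine fun m => ⟨n, fun k hk => ?_⟩
  rw [← Finset.sum_subset (Finset.range_mono hk) fun j _ hj => hu j (by simpa using hj), sub_self]
  exact zero_mem _

/-- Both `x` and `0` are limits of the constant sequence `0`, and limits are unique. -/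
theorem IsWeakFiltration.eq_zero_of_mem {𝒢 : ℤ → Submodule K V}
    {l : (k : ℕ) → MultilinearMap K (fun _ : Fin k => V) V} {F : ℕ → Submodule K V}
    (hF : IsWeakFiltration 𝒢 l F) {d : ℤ} {x : V} (hx : x ∈ 𝒢 d) (h : ∀ k, x ∈ F k) : x = 0 := by
  obtain ⟨y, _, hy⟩ := hF.complete d (fun _ => 0) (fun _ => zero_mem _) (fun k => by simp)
  rw [hy x ⟨hx, fun k => by simpa using h k⟩, hy 0 ⟨zero_mem _, fun k => by simp⟩]

/-- This makes the Maurer-Cartan equation a finite identity that does not depend on the filtration.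
-/
theorem hasFilteredSum_zero_iff {𝒢 : ℤ → Submodule K V}
    {l : (k : ℕ) → MultilinearMap K (fun _ : Fin k => V) V} {F : ℕ → Submodule K V}
    (hF : IsWeakFiltration 𝒢 l F) {u : ℕ → V} {n : ℕ} (hu : ∀ k, n ≤ k → u k = 0) {d : ℤ}
    (hd : ∑ j ∈ Finset.range n, u j ∈ 𝒢 d) :
    HasFilteredSum F u 0 ↔ ∑ j ∈ Finset.range n, u j = 0 := by
  constructor
  · intro h
    refine hF.eq_zero_of_mem hd fun m => ?_
    obtain ⟨n₀, hn₀⟩ := h m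
    have := hn₀ (max n n₀) (le_max_right _ _)
    rwa [sub_zero, ← Finset.sum_subset (Finset.range_mono (le_max_left n n₀))
      fun j _ hj => hu j (by simpa using hj)] at this
  · intro h
    have := hasFilteredSum_of_eventually_zero F hu
    rwa [h] at this

theorem exists_isWeakFiltration {𝒢 : ℤ → Submodule K V} (h𝒢 : DirectSum.IsInternal 𝒢)
    {l : (k : ℕ) → MultilinearMap K (fun _ : Fin k => V) V} {n : ℕ} (hn : 1 ≤ n)
    (hl : ∀ k, n < k → l k = 0) : ∃ F, IsWeakFiltration 𝒢 l F := by
  classical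
  -- A filtration that drops to `0` after step `n` works: compatible sequences are constant from
  -- index `n + 1` on.
  refine ⟨fun k => if k ≤ n then ⊤ else ⊥, ?_, if_pos hn, ?_, ?_, n + 1, ?_⟩
  · intro a b hab
    by_cases hb : b ≤ n
    · simp [hab.trans hb]
    · simp [hb]
  · intro k
    by_cases hk : k ≤ n
    · simp [hk, h𝒢.submodule_iSup_eq_top]
    · simp [hk]
  · intro d u hu hu'
    have hconst : ∀ k, n + 1 ≤ k → u k = u (n + 1) := fun k hk => by
      induction k, hk using Nat.le_induction with
      | base => rfl
      | succ k hk ih =>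
        have := hu' k
        rw [if_neg (by omega), Submodule.mem_bot, sub_eq_zero] at this
        rw [this, ih]
    refine ⟨u (n + 1), ⟨hu _, fun k => ?_⟩, fun y hy => ?_⟩
    · by_cases hk : k ≤ n
      · simp [hk]
      · simp [hk, hconst k (by omega)]
    · have := hy.2 (n + 1)
      rwa [if_neg (by omega), Submodule.mem_bot, sub_eq_zero] at this
  · intro k hk x
    simp [hl k hk]

end LInfty

/-! ### Maurer-Cartan elements are weak deformation maps. -/

namespace QuasiTwilled

variable {K A B : Type*} [Field K] [AddCommGroup A] [Module K A] [AddCommGroup B] [Module K B]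
variable (Q : QuasiTwilled K A B)

open Gerst BSpace

theorem exists_isWeakFiltration_l : ∃ F, LInfty.IsWeakFiltration (grading K A B) Q.l F :=
  LInfty.exists_isWeakFiltration (GradedHom.isInternal_grading K B A) (n := 3) (by norm_num)
    fun _ hk => Q.l_eq_zero hk

variable (K) in
/-- The extension of `r : B → A` to `A × B`. -/
def extend (r : B →ₗ[K] A) : A × B →ₗ[K] A × B :=
  LinearMap.inl K A B ∘ₗ r ∘ₗ LinearMap.snd K A B

theorem incl_ofLinear (r : B →ₗ[K] A) :
    incl K A B (ofLinear r) = GradedHom.of K (A × B) (A × B) 0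
      (MultilinearMap.ofSubsingleton K (A × B) (A × B) (0 : Fin 1) (extend K r)) := by
  rw [ofLinear, incl_of]
  rfl

theorem proj_bilin (β : A × B →ₗ[K] A × B →ₗ[K] A × B) :
    proj K A B (GradedHom.of K (A × B) (A × B) 1 (bilinToMultilin β))
      = GradedHom.of K B A 1 (bilinToMultilin
          ((β.compl₁₂ (LinearMap.inr K A B) (LinearMap.inr K A B)).compr₂
            (LinearMap.fst K A B))) := by
  rw [proj_of]
  rfl

/-- `(x, y) ↦ r(x) ·_A r(y) + r(x) ↼ y + x ⇀ r(y) - r(x ·_r y)`. -/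
def deformationDefect (r : B →ₗ[K] A) : B →ₗ[K] B →ₗ[K] A :=
  Q.mulA.compl₁₂ r r + Q.lharp.compl₁₂ r LinearMap.id + Q.rharp.compl₁₂ LinearMap.id r
    - (Q.mulBr r).compr₂ r

theorem deformationDefect_eq_zero_iff (r : B →ₗ[K] A) :
    Q.deformationDefect r = 0 ↔ Q.IsWeakDeformationMap r := by
  refine LinearMap.ext_iff.trans (forall_congr' fun x => LinearMap.ext_iff.trans
    (forall_congr' fun y => ?_))
  exact sub_eq_zero

theorem maurerCartan_sum [CharZero K] (r : B →ₗ[K] A) :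
    ∑ k ∈ Finset.range 4, ((Nat.factorial k : K)⁻¹) • Q.l k (fun _ => ofLinear r)
      = GradedHom.of K B A 1 (bilinToMultilin (Q.deformationDefect r)) := by
  have e1 : Q.l 1 (fun _ => ofLinear r) = Q.l 1 ![ofLinear r] :=
    congrArg _ (funext fun i => by fin_cases i; rfl)
  have e2 : Q.l 2 (fun _ => ofLinear r) = Q.l 2 ![ofLinear r, ofLinear r] :=
    congrArg _ (funext fun i => by fin_cases i <;> rfl)
  have e3 : Q.l 3 (fun _ => ofLinear r) = Q.l 3 ![ofLinear r, ofLinear r, ofLinear r] :=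
    congrArg _ (funext fun i => by fin_cases i <;> rfl)
  have e0 : Q.l 0 (fun _ => ofLinear r) = 0 := rfl
  simp only [Finset.sum_range_succ, Finset.sum_range_zero, e0, e1, e2, e3, l_one, l_two, l_three,
    incl_ofLinear, nuElt, muElt, thetaElt, bracket_bilin_linear, proj_bilin, smul_zero, zero_add]
  rw [← map_smul, ← map_smul, ← map_smul, ← map_add, ← map_add, ← bilinToMultilin_smul,
    ← bilinToMultilin_smul, ← bilinToMultilin_smul, ← bilinToMultilin_add, ← bilinToMultilin_add]
  congr 2
  ext x y
  -- The extension of `r` has square zero, so on `B` the double bracket with `μ` gives each of its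
  -- terms twice and the triple bracket with `θ~` gives `-r(θ(r x, r y))` six times; the factorials
  -- cancel these multiplicities.
  have h2 : ((Nat.factorial 2 : ℕ) : K)⁻¹ = 1 / 2 := by norm_num
  have h3 : ((Nat.factorial 3 : ℕ) : K)⁻¹ = 1 / 6 := by norm_num [Nat.factorial]
  rw [h2, h3]
  simp [bilinDerive, extend, deformationDefect, mulBr]
  module

theorem isMaurerCartan_iff [CharZero K] {F : ℕ → Submodule K (BSpace K A B)}
    (hF : LInfty.IsWeakFiltration (grading K A B) Q.l F) (r : B →ₗ[K] A) :
    LInfty.IsMaurerCartan (grading K A B) Q.l F (ofLinear r) ↔ Q.IsWeakDeformationMap r := by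
  have h0 : ofLinear r ∈ grading K A B 0 := GradedHom.of_mem_grading 0 _ rfl
  have hs := Q.maurerCartan_sum r
  rw [LInfty.IsMaurerCartan, and_iff_right h0, LInfty.hasFilteredSum_zero_iff hF (n := 4) (d := 1)
    (fun k hk => by rw [Q.l_eq_zero hk]; exact smul_zero _)
    (by rw [hs]; exact GradedHom.of_mem_grading 1 _ rfl), hs,
    ← Q.deformationDefect_eq_zero_iff]
  constructor
  · intro h
    have h' := GradedHom.of_injective 1 (h.trans (map_zero _).symm)
    ext x y
    exact congrArg (fun f => f ![x, y]) h'
  · intro h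
    rw [h]
    exact map_zero _

/-! ### Twisting by `r` and the Hochschild coboundary. -/

section twisted

variable {Q} {r : B →ₗ[K] A} (hr : Q.IsWeakDeformationMap r)

theorem muElt_twist : (twist hr).muElt
    = Q.muElt + bracket K (A × B) Q.thetaElt (incl K A B (ofLinear r)) := by
  rw [incl_ofLinear]
  simp only [muElt, thetaElt]
  rw [bracket_bilin_linear, ← map_add, ← bilinToMultilin_add]
  congr 2
  refine LinearMap.ext₂ fun u v => Prod.ext ?_ ?_ <;>
  simp [bilinDerive, extend, twist, ofAssoc, mulAr, trir, ltrir] <;> abel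

/-- Conjugation by the shear is `exp([·, r])`, and each bracket with `r` lowers the weight by one.
This is the component of weight `0` of `exp([·, r])Δ`, as `muElt_twist` is that of weight `1`; the
component of weight `2` remains `θ~`. -/
theorem nuElt_twist [CharZero K] : (twist hr).nuElt
    = Q.nuElt + bracket K (A × B) Q.muElt (incl K A B (ofLinear r))
      + (1 / 2 : K) • bracket K (A × B) (bracket K (A × B) Q.thetaElt (incl K A B (ofLinear r)))
        (incl K A B (ofLinear r)) := by
  rw [incl_ofLinear]
  simp only [muElt, thetaElt, nuElt]
  rw [bracket_bilin_linear, bracket_bilin_linear, bracket_bilin_linear, ← map_smul, ← map_add,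
    ← map_add, ← bilinToMultilin_smul, ← bilinToMultilin_add, ← bilinToMultilin_add]
  congr 2
  refine LinearMap.ext₂ fun u v => Prod.ext ?_ ?_
  · simp [bilinDerive, extend, twist, ofAssoc, mulBr, rharpr, lharpr]
    module
  · simp [bilinDerive, extend, twist, ofAssoc, mulBr, rharpr, lharpr]
    module

theorem l_one_twist [CharZero K] (f : BSpace K A B) :
    (twist hr).l 1 ![f] = Q.l 1 ![f] + Q.l 2 ![ofLinear r, f]
      + (1 / 2 : K) • Q.l 3 ![ofLinear r, ofLinear r, f] := by
  simp only [l_one, l_two, l_three, nuElt_twist, map_add, map_smul, LinearMap.add_apply,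
    LinearMap.smul_apply]

theorem l_two_twist (f g : BSpace K A B) :
    (twist hr).l 2 ![f, g] = Q.l 2 ![f, g] + Q.l 3 ![ofLinear r, f, g] := by
  simp only [l_two, l_three, muElt_twist, map_add, LinearMap.add_apply]

theorem l_three_twist (f g h : BSpace K A B) :
    (twist hr).l 3 ![f, g, h] = Q.l 3 ![f, g, h] := rfl

theorem l_comp_cast {m k : ℕ} (e : m = k) (x : Fin k → BSpace K A B) :
    Q.l m (x ∘ Fin.cast e) = Q.l k x := by
  subst e; rfl

theorem isTwist_twist [CharZero K] (F : ℕ → Submodule K (BSpace K A B)) :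
    LInfty.IsTwist Q.l F (ofLinear r) (twist hr).l := by
  refine ⟨rfl, fun k hk x => ?_⟩
  -- Since `k ≥ 1`, three or more copies of `r` give an operation of arity at least `4`, which is
  -- zero.
  have key := LInfty.hasFilteredSum_of_eventually_zero F (n := 3)
    (u := fun n => ((Nat.factorial n : K)⁻¹) • Q.l (n + k) (Fin.append (fun _ => ofLinear r) x))
    fun n hn => by rw [Q.l_eq_zero (by omega)]; exact smul_zero _
  convert key using 1
  simp only [Finset.sum_range_succ, Finset.sum_range_zero, zero_add, Nat.factorial_zero,
    Nat.factorial_one, Nat.factorial_two, Nat.cast_one, inv_one, one_smul]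
  have z : ∀ {m} (_ : 4 ≤ m) (y : Fin m → BSpace K A B), Q.l m y = 0 := fun h y => by
    rw [Q.l_eq_zero h]; rfl
  rw [Fin.append_left_nil _ _ rfl, l_comp_cast]
  obtain rfl | rfl | rfl | hk4 : k = 1 ∨ k = 2 ∨ k = 3 ∨ 4 ≤ k := by omega
  · obtain ⟨f, rfl⟩ : ∃ f, x = ![f] := ⟨x 0, funext fun i => by fin_cases i; rfl⟩
    have e1 : Fin.append (fun _ : Fin 1 => ofLinear r) ![f] = ![ofLinear r, f] :=
      funext fun i => by fin_cases i <;> rfl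
    have e2 : Fin.append (fun _ : Fin 2 => ofLinear r) ![f] = ![ofLinear r, ofLinear r, f] :=
      funext fun i => by fin_cases i <;> rfl
    rw [e1, e2, l_one_twist, one_div, Nat.cast_ofNat]
  · obtain ⟨f, g, rfl⟩ : ∃ f g, x = ![f, g] :=
      ⟨x 0, x 1, funext fun i => by fin_cases i <;> rfl⟩
    have e1 : Fin.append (fun _ : Fin 1 => ofLinear r) ![f, g] = ![ofLinear r, f, g] :=
      funext fun i => by fin_cases i <;> rfl
    rw [z (show 4 ≤ 2 + 2 by norm_num), smul_zero, add_zero, e1, l_two_twist]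
  · rw [z (show 4 ≤ 2 + 3 by norm_num), z (show 4 ≤ 1 + 3 by norm_num), smul_zero, add_zero,
      add_zero]
    rfl
  · rw [z (show 4 ≤ 2 + k by omega), z (show 4 ≤ 1 + k by omega), z hk4, smul_zero, add_zero,
      add_zero, l_eq_zero _ hk4]
    rfl

theorem evalSeq_delta {n : ℕ} (f : MultilinearMap K (fun _ : Fin (n + 1) => B) A) (b : ℕ → B) :
    evalSeq (Q.delta r f) b = Q.rharpr r (b 0) (evalSeq f fun t => b (t + 1))
      + ∑ i ∈ Finset.range (n + 1), ((-1 : K) ^ (i + 1)) •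
          evalSeq f (insertSeq 1 i (fun a => Q.mulBr r (a 0) (a 1)) b)
      + ((-1 : K) ^ n) • Q.lharpr r (evalSeq f b) (b (n + 1)) := by
  have h1 : ∀ i : Fin (n + 1), evalSeq (insertion f (bilinToMultilin (Q.mulBr r)) i
      (show n + 1 + 2 = n + 1 + 1 + 1 by omega)) b
        = evalSeq f (insertSeq 1 i (fun a => Q.mulBr r (a 0) (a 1)) b) :=
    fun i => evalSeq_insertion f _ i _ b
  rw [Finset.sum_range]
  simp only [← h1, ← evalSeq_smul, ← evalSeq_sum]
  -- Here `f` has `n + 1` inputs, so the last sign in `delta` is `(-1)^(n + 2)`.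
  rw [show (-1 : K) ^ n = (-1) ^ (n + 1 + 1) by rw [pow_succ, pow_succ]; ring]
  rfl

theorem evalSeq_nu (a : ℕ → A × B) :
    evalSeq (bilinToMultilin
      ((Q.lharp.compl₁₂ (LinearMap.fst K A B) (LinearMap.snd K A B)
        + Q.rharp.compl₁₂ (LinearMap.snd K A B) (LinearMap.fst K A B)).compr₂
          (LinearMap.inl K A B)
      + (Q.mulB.compl₁₂ (LinearMap.snd K A B) (LinearMap.snd K A B)).compr₂
          (LinearMap.inr K A B))) a
      = (Q.lharp (a 0).1 (a 1).2 + Q.rharp (a 0).2 (a 1).1, Q.mulB (a 0).2 (a 1).2) := by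
  refine Prod.ext ?_ ?_
  · exact add_zero _
  · exact zero_add _

/-- Let `ν'` be the twisted `ν`. On inputs from `B`, `ν' ⋄ f` gives the two outer terms of the
coboundary, `f` being inserted in the left or right slot, and `f ⋄ ν'` gives the terms with a
product `x_i ·_r x_{i+1}`. The sign in the bracket is `(-1)^n`, which is the overall factor. -/
theorem l_one_twist_of {n : ℕ} (f : MultilinearMap K (fun _ : Fin (n + 1) => B) A) :
    (twist hr).l 1 ![GradedHom.of K B A n f]
      = ((-1 : K) ^ n) • GradedHom.of K B A (n + 1) (Q.delta r f) := by
  have hev : ∀ {m : ℕ} (F : MultilinearMap K (fun _ : Fin (m + 1) => A × B) (A × B)) (b : ℕ → B),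
      evalSeq ((LinearMap.fst K A B).compMultilinearMap
        (F.compLinearMap fun _ => LinearMap.inr K A B)) b
      = (evalSeq F fun t => (0, b t)).1 := fun F b => rfl
  have hg : ∀ a : ℕ → A × B, evalSeq ((LinearMap.inl K A B).compMultilinearMap
      (f.compLinearMap fun _ => LinearMap.snd K A B)) a = (evalSeq f fun t => (a t).2, 0) :=
    fun a => rfl
  have hss : ((-1 : K) ^ n) * (-1) ^ n = 1 := by
    rw [← pow_add]; exact (Even.add_self _).neg_one_pow
  rw [l_one, incl_of, nuElt, bracket_of, map_sub, map_smul, proj_of, proj_of, one_mul,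
    sub_eq_iff_eq_add, ← smul_add, ← map_add, ← map_smul]
  -- The two sides are in degrees `1 + n` and `n + 1`.
  refine GradedHom.of_congr (add_comm 1 n) fun b => ?_
  have hadd : ∀ {m : ℕ} (F G : MultilinearMap K (fun _ : Fin m => B) A),
    evalSeq (F + G) b = evalSeq F b + evalSeq G b := fun F G => rfl
  rw [evalSeq_smul, hadd, hev, hev, evalSeq_diamond, evalSeq_diamond, evalSeq_delta]
  have hins : ∀ i, evalSeq f (fun t => (insertSeq 1 i (fun a => ((twist hr).lharp (a 0).1 (a 1).2
        + (twist hr).rharp (a 0).2 (a 1).1, (twist hr).mulB (a 0).2 (a 1).2))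
        (fun t => ((0 : A), b t)) t).2)
      = evalSeq f (insertSeq 1 i (fun a => Q.mulBr r (a 0) (a 1)) b) := fun i => by
    congr 1
    funext t
    simp only [insertSeq]
    split_ifs <;> rfl
  simp only [Finset.sum_range_succ _ 1, Finset.sum_range_one, evalSeq_nu, hg, Prod.fst_sum,
    Prod.smul_fst, Prod.fst_add, funext (evalSeq_nu (Q := twist hr)), hins]
  have e1 : ∀ G : (ℕ → A × B) → A × B, insertSeq n 0 G (fun t => ((0 : A), b t)) 0
      = G fun t => (0, b (0 + t)) := fun G => rfl
  have e2 : ∀ G : (ℕ → A × B) → A × B, insertSeq n 0 G (fun t => ((0 : A), b t)) 1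
      = (0, b (1 + n)) := fun G => rfl
  have e3 : ∀ G : (ℕ → A × B) → A × B, insertSeq n 1 G (fun t => ((0 : A), b t)) 0
      = (0, b 0) := fun G => rfl
  have e4 : ∀ G : (ℕ → A × B) → A × B, insertSeq n 1 G (fun t => ((0 : A), b t)) 1
      = G fun t => (0, b (1 + t)) := fun G => rfl
  simp only [e1, e2, e3, e4, pow_succ _ _, zero_mul, one_mul, pow_zero, one_smul,
    map_zero, LinearMap.zero_apply, add_zero, zero_add, mul_neg, mul_one, neg_smul,
    Finset.sum_neg_distrib, smul_add, smul_neg, smul_smul, hss]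
  simp only [add_comm 1]
  change Q.lharpr r (evalSeq f b) _ + _ • Q.rharpr r (b 0) (evalSeq f fun t => b (t + 1)) = _
  abel

end twisted

end QuasiTwilled

theorem mainTheorem7 {K A B : Type*} [Field K] [CharZero K] [AddCommGroup A] [Module K A]
    [AddCommGroup B] [Module K B] (Q : QuasiTwilled K A B) (r : B →ₗ[K] A)
    (hr : Q.IsWeakDeformationMap r) :
    -- the operations `l` of the controlling algebra are the brackets taken in `𝔤`
    (∀ f, BSpace.incl K A B (Q.l 1 ![f])
        = Gerst.bracket K (A × B) Q.nuElt (BSpace.incl K A B f)) ∧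
    (∀ f g, BSpace.incl K A B (Q.l 2 ![f, g])
        = Gerst.bracket K (A × B) (Gerst.bracket K (A × B) Q.muElt (BSpace.incl K A B f))
            (BSpace.incl K A B g)) ∧
    (∀ f g h, BSpace.incl K A B (Q.l 3 ![f, g, h])
        = Gerst.bracket K (A × B)
            (Gerst.bracket K (A × B)
              (Gerst.bracket K (A × B) Q.thetaElt (BSpace.incl K A B f))
              (BSpace.incl K A B g))
            (BSpace.incl K A B h)) ∧
    -- they form a weakly filtered `L_∞`-algebra
    LInfty.IsLInfinity (BSpace.grading K A B) Q.l ∧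
    (∃ F, LInfty.IsWeakFiltration (BSpace.grading K A B) Q.l F) ∧
    ∃ lr : (k : ℕ) → MultilinearMap K (fun _ : Fin k => BSpace K A B) (BSpace K A B),
      -- `r` is a Maurer-Cartan element, and `lr` is the twist of `l` by `r`
      (∀ F, LInfty.IsWeakFiltration (BSpace.grading K A B) Q.l F →
        LInfty.IsMaurerCartan (BSpace.grading K A B) Q.l F (BSpace.ofLinear r) ∧
        LInfty.IsTwist Q.l F (BSpace.ofLinear r) lr) ∧
      -- the twisted operations
      lr 0 = 0 ∧
      (∀ f, lr 1 ![f] = Q.l 1 ![f] + Q.l 2 ![BSpace.ofLinear r, f]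
        + (1 / 2 : K) • Q.l 3 ![BSpace.ofLinear r, BSpace.ofLinear r, f]) ∧
      (∀ f g, lr 2 ![f, g] = Q.l 2 ![f, g] + Q.l 3 ![BSpace.ofLinear r, f, g]) ∧
      (∀ f g h, lr 3 ![f, g, h] = Q.l 3 ![f, g, h]) ∧
      (∀ k, 4 ≤ k → lr k = 0) ∧
      -- they form a weakly filtered `L_∞`-algebra
      LInfty.IsLInfinity (BSpace.grading K A B) lr ∧
      (∃ F, LInfty.IsWeakFiltration (BSpace.grading K A B) lr F) ∧
      -- its Maurer-Cartan elements of the form `r'` are the deformations of `r`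
      (∀ F, LInfty.IsWeakFiltration (BSpace.grading K A B) lr F → ∀ r' : B →ₗ[K] A,
        (Q.IsWeakDeformationMap (r + r') ↔
          LInfty.IsMaurerCartan (BSpace.grading K A B) lr F (BSpace.ofLinear r'))) ∧
      -- `l_1^r(f) = (-1)^n δ^r(f)` for `f ∈ 𝔟_n = Hom(B^{⊗ n+1}, A)`
      (∀ (n : ℕ) (f : MultilinearMap K (fun _ : Fin (n + 1) => B) A),
        lr 1 ![Gerst.GradedHom.of K B A n f]
          = ((-1 : K) ^ n) • Gerst.GradedHom.of K B A (n + 1) (Q.delta r f)) := by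
  -- The witness for the twisted operations is the controlling algebra of `twist hr`, so its `L_∞`
  -- and filtration properties are instances of those of `Q`.
  refine ⟨Q.incl_l_one, Q.incl_l_two, Q.incl_l_three, Q.isLInfinity_l, Q.exists_isWeakFiltration_l,
    (QuasiTwilled.twist hr).l, fun F hF => ⟨(Q.isMaurerCartan_iff hF r).2 hr,
      QuasiTwilled.isTwist_twist hr F⟩, rfl, QuasiTwilled.l_one_twist hr,
    QuasiTwilled.l_two_twist hr, QuasiTwilled.l_three_twist hr,
    fun k hk => QuasiTwilled.l_eq_zero _ hk, QuasiTwilled.isLInfinity_l _,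
    QuasiTwilled.exists_isWeakFiltration_l _, fun F hF s => ?_,
    fun n f => QuasiTwilled.l_one_twist_of hr f⟩
  rw [QuasiTwilled.isMaurerCartan_iff _ hF, QuasiTwilled.isWeakDeformationMap_twist_iff]
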